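/- Let $N=\{1,\dots,n\}$ be a finite set of players. A hedonic game is given by utilities $v_i(S)\in\mathbb{R}$ for all $i\in S\subseteq N$. A coalition structure is a partition $\pi$ of $N$ into coalitions, and $\pi(i)$ is the coalition of $i$; a nonempty $S\subseteq N$ strongly blocks $\pi$ if $v_i(S)>v_i(\pi(i))$ for all $i\in S$. For an undirected graph $G$ on $N$, a coalition is feasible if it is connected in $G$, and $\mathcal{H}_G$ is the class of all hedonic games on $N$ such that, for every player $i$, $v_i(\{i\})=0$ and $v_i(S)<0$ for every $S\ni i$ that is not connected in $G$. Let $\mathcal{H}^*=\bigcup\{\mathcal{H}_G : G \text{ is a forest}\}$. For a probability distribution $\mathcal{D}$ on $2^N$, a coalition structure $\pi$ is $\varepsilon$-PAC stable with respect to $\mathcal{D}$ if $\Pr_{S\sim\mathcal{D}}[S\text{ strongly blocks }\pi]<\varepsilon$. **Theorem.** $\mathcal{H}^*$ is efficiently PAC stabilizable. That is, there are an algorithm $\mathcal{A}$, a sample size $m=m(n,\varepsilon,\delta)$ and a polynomial $p$ with nonnegative coefficients such that for all $n$, all $\varepsilon,\delta>0$, every forest $G$ on $N$ and every game in $\mathcal{H}_G$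 the following holds. 1. $m$ is at most $p\big(n,\tfrac1\varepsilon,\max\{0,\log\tfrac1\delta\}\big)$. 2. The input of $\mathcal{A}$ consists of $n$, $m$, $\varepsilon$, $\delta$, coalitions $S_1,\dots,S_m\subseteq N$ and the values $(v_i(S_j))_{i\in S_j}$ for $j=1,\dots,m$; the forest $G$ is not part of the input. For all $S_1,\dots,S_m$, $\mathcal{A}$ halts after at most $p\big(n,\tfrac1\varepsilon,\max\{0,\log\tfrac1\delta\}\big)$ steps of a random access machine that adds, subtracts and compares natural numbers and that copies and compares real numbers at unit cost. 3. For every probability distribution $\mathcal{D}$ on $2^N$, if $S_1,\dots,S_m$ are drawn independently from $\mathcal{D}$, then with probability at least $1-\delta$ the output of $\mathcal{A}$ is a coalition structure that is $\varepsilon$-PAC stable with respect to $\mathcal{D}$ and all of whose coalitions are connected in $G$. -/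

import Mathlib

namespace HedonicPAC

/-! ## Hedonic games with an interaction graph -/

/-- A hedonic game on the players `Fin n`: `v i S` is the utility of player `i` for the coalition
`S`. Only the values with `i ∈ S` are ever used. -/
abbrev HedonicGame (n : ℕ) := Fin n → Finset (Fin n) → ℝ

/-- A coalition structure: a partition of the player set; the coalition of `i` is `π.part i`. -/
abbrev CoalitionStructure (n : ℕ) := Finpartition (Finset.univ : Finset (Fin n))

/-- A (nonempty) coalition `S` strongly blocks `π` if every member strictly prefers `S` to its
current coalition. -/
def StronglyBlocks {n : ℕ} (v : HedonicGame n) (π : CoalitionStructure n)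
    (S : Finset (Fin n)) : Prop :=
  S.Nonempty ∧ ∀ i ∈ S, v i (π.part i) < v i S

/-- Feasible coalitions: the vertex sets that induce a connected subgraph. -/
def Feasible {n : ℕ} (G : SimpleGraph (Fin n)) (S : Finset (Fin n)) : Prop :=
  (G.induce (S : Set (Fin n))).Connected

/-- The games of the graph `G`: the singleton has value `0`, and every disconnected coalition has
negative value for each of its members. -/
def gamesOn {n : ℕ} (G : SimpleGraph (Fin n)) : Set (HedonicGame n) :=
  {v | ∀ i, v i {i} = 0 ∧ ∀ S : Finset (Fin n), i ∈ S → ¬ Feasible G S → v i S < 0}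

/-- A hedonic graph game: players, utilities and an interaction graph. -/
structure HedonicGraphGame (n : ℕ) where
  utility : HedonicGame n
  graph : SimpleGraph (Fin n)

/-- All hedonic games whose interaction graph is some forest. -/
def forestGames (n : ℕ) : Set (HedonicGraphGame n) :=
  {Γ | Γ.graph.IsAcyclic ∧ Γ.utility ∈ gamesOn Γ.graph}

/-! ## Probabilities on the finite spaces of coalitions and of samples -/

open Classical in
/-- The probability that a coalition drawn from `D` has the property `E`. -/
noncomputable def prob {n : ℕ} (D : PMF (Finset (Fin n))) (E : Finset (Fin n) → Prop) : ℝ :=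
  ∑ S with E S, (D S).toReal

open Classical in
/-- The probability that `m` coalitions drawn independently from `D` have the property `E`. -/
noncomputable def sampleProb {n : ℕ} (D : PMF (Finset (Fin n))) (m : ℕ)
    (E : (Fin m → Finset (Fin n)) → Prop) : ℝ :=
  ∑ ω with E ω, ∏ j, (D (ω j)).toReal

/-- `π` is `ε`-PAC stable with respect to `D`. -/
def IsPACStable {n : ℕ} (v : HedonicGame n) (D : PMF (Finset (Fin n))) (ε : ℝ)
    (π : CoalitionStructure n) : Prop :=
  prob D (StronglyBlocks v π) < ε

/-! ## The machine model

Programs are structured random access machine programs. A program works on finitely many named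
two-dimensional arrays of natural numbers and of real numbers, the indices being computed at run
time. Natural numbers can be added and subtracted (not multiplied, so that in `t` steps only
numbers with `O(t)` more bits than the input can arise). Real numbers are stored in one cell each,
and can only be copied and compared. Every assignment and every test counts as one step;
an expression has a fixed size in the program. -/

/-- The memory: `nat a i j` and `real a i j` are the entries `(i, j)` of the arrays named `a`. -/
structure Memory where
  nat : ℕ → ℕ → ℕ → ℕ
  real : ℕ → ℕ → ℕ → ℝ

/-- Expressions with values in the natural numbers. -/
inductive Expr where
  | const (c : ℕ)
  | load (a : ℕ) (i j : Expr)
  | add (e f : Expr)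
  | sub (e f : Expr)

/-- The value of an expression; subtraction is truncated at `0`. -/
def Expr.eval (s : Memory) : Expr → ℕ
  | .const c => c
  | .load a i j => s.nat a (i.eval s) (j.eval s)
  | .add e f => e.eval s + f.eval s
  | .sub e f => e.eval s - f.eval s

/-- A real array cell, with computed indices. -/
structure RealCell where
  name : ℕ
  row : Expr
  col : Expr

/-- The content of a real array cell. -/
def RealCell.eval (s : Memory) (x : RealCell) : ℝ :=
  s.real x.name (x.row.eval s) (x.col.eval s)

/-- Tests. -/
inductive Test where
  | natLe (e f : Expr)
  | realLe (x y : RealCell)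
  | not (b : Test)
  | and (b c : Test)

/-- The truth value of a test. -/
def Test.Holds (s : Memory) : Test → Prop
  | .natLe e f => e.eval s ≤ f.eval s
  | .realLe x y => x.eval s ≤ y.eval s
  | .not b => ¬ b.Holds s
  | .and b c => b.Holds s ∧ c.Holds s

/-- Write `x` into the entry `(i, j)` of the array `a` of natural numbers. -/
def Memory.setNat (s : Memory) (a i j x : ℕ) : Memory :=
  { s with nat := fun a' i' j' => if a' = a ∧ i' = i ∧ j' = j then x else s.nat a' i' j' }

/-- Write `x` into the entry `(i, j)` of the array `a` of real numbers. -/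
noncomputable def Memory.setReal (s : Memory) (a i j : ℕ) (x : ℝ) : Memory :=
  { s with real := fun a' i' j' => if a' = a ∧ i' = i ∧ j' = j then x else s.real a' i' j' }

/-- Programs: `a[i, j] := e` for natural numbers, copying of a real cell, sequential composition,
conditionals and while loops. -/
inductive Program where
  | skip
  | assign (a : ℕ) (i j e : Expr)
  | copy (x y : RealCell)
  | seq (p q : Program)
  | ite (b : Test) (p q : Program)
  | loop (b : Test) (p : Program)

/-- `Exec p s s' t`: started in the memory `s`, the program `p` halts after exactly `t` steps in
the memory `s'`. -/
inductive Exec : Program → Memory → Memory → ℕ → Prop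
  | skip (s : Memory) : Exec .skip s s 1
  | assign (s : Memory) (a : ℕ) (i j e : Expr) :
      Exec (.assign a i j e) s (s.setNat a (i.eval s) (j.eval s) (e.eval s)) 1
  | copy (s : Memory) (x y : RealCell) :
      Exec (.copy x y) s (s.setReal x.name (x.row.eval s) (x.col.eval s) (y.eval s)) 1
  | seq {p q : Program} {s s' s'' : Memory} {t u : ℕ} :
      Exec p s s' t → Exec q s' s'' u → Exec (.seq p q) s s'' (t + u)
  | ite_true {b : Test} {p q : Program} {s s' : Memory} {t : ℕ} :
      b.Holds s → Exec p s s' t → Exec (.ite b p q) s s' (t + 1)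
  | ite_false {b : Test} {p q : Program} {s s' : Memory} {t : ℕ} :
      ¬ b.Holds s → Exec q s s' t → Exec (.ite b p q) s s' (t + 1)
  | loop_false {b : Test} {p : Program} {s : Memory} :
      ¬ b.Holds s → Exec (.loop b p) s s 1
  | loop_true {b : Test} {p : Program} {s s' s'' : Memory} {t u : ℕ} :
      b.Holds s → Exec p s s' t → Exec (.loop b p) s' s'' u →
      Exec (.loop b p) s s'' (t + u + 1)

/-- Programs are deterministic: final memory and number of steps are determined by the start. -/
theorem Exec.deterministic {p : Program} {s s₁ s₂ : Memory} {t₁ t₂ : ℕ}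
    (h₁ : Exec p s s₁ t₁) (h₂ : Exec p s s₂ t₂) : s₁ = s₂ ∧ t₁ = t₂ := by
  induction h₁ generalizing s₂ t₂ with
  | skip => cases h₂; exact ⟨rfl, rfl⟩
  | assign => cases h₂; exact ⟨rfl, rfl⟩
  | copy => cases h₂; exact ⟨rfl, rfl⟩
  | seq _ _ ihp ihq =>
    cases h₂ with
    | seq hp hq =>
      obtain ⟨rfl, rfl⟩ := ihp hp
      obtain ⟨rfl, rfl⟩ := ihq hq
      exact ⟨rfl, rfl⟩
  | ite_true hb _ ih =>
    cases h₂ with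
    | ite_true _ hp => obtain ⟨rfl, rfl⟩ := ih hp; exact ⟨rfl, rfl⟩
    | ite_false hb' _ => exact absurd hb hb'
  | ite_false hb _ ih =>
    cases h₂ with
    | ite_true hb' _ => exact absurd hb' hb
    | ite_false _ hp => obtain ⟨rfl, rfl⟩ := ih hp; exact ⟨rfl, rfl⟩
  | loop_false hb =>
    cases h₂ with
    | loop_false _ => exact ⟨rfl, rfl⟩
    | loop_true hb' _ _ => exact absurd hb' hb
  | loop_true hb _ _ ihp ihl =>
    cases h₂ with
    | loop_false hb' => exact absurd hb hb'
    | loop_true _ hp hl =>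
      obtain ⟨rfl, rfl⟩ := ihp hp
      obtain ⟨rfl, rfl⟩ := ihl hl
      exact ⟨rfl, rfl⟩

/-! ## PAC stabilizing algorithms -/

/-- The start memory. Array `0` of natural numbers holds the number of players and the number of
samples at `(0, 0)` and `(0, 1)`; entry `(j, i)` of array `1` tells (by `1` or `0`) whether player
`i` is in the sample `S_j`. Array `0` of real numbers holds `ε` and `δ` at `(0, 0)` and `(0, 1)`;
entry `(j, i)` of array `1` is `v_i(S_j)` if `i` is in `S_j`. All other entries are `0`. -/
noncomputable def inputMemory {n m : ℕ} (v : HedonicGame n) (ε δ : ℝ)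
    (ω : Fin m → Finset (Fin n)) : Memory where
  nat a r c :=
    if a = 0 ∧ r = 0 ∧ c = 0 then n
    else if a = 0 ∧ r = 0 ∧ c = 1 then m
    else if h : a = 1 ∧ r < m ∧ c < n then
      if (⟨c, h.2.2⟩ : Fin n) ∈ ω ⟨r, h.2.1⟩ then 1 else 0
    else 0
  real a r c :=
    if a = 0 ∧ r = 0 ∧ c = 0 then ε
    else if a = 0 ∧ r = 0 ∧ c = 1 then δ
    else if h : a = 1 ∧ r < m ∧ c < n then
      if (⟨c, h.2.2⟩ : Fin n) ∈ ω ⟨r, h.2.1⟩ then v ⟨c, h.2.2⟩ (ω ⟨r, h.2.1⟩) else 0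
    else 0

open Classical in
/-- The output: players `i` and `j` are in the same coalition if and only if the entries `(0, i)`
and `(0, j)` of array `2` of natural numbers are equal. -/
noncomputable def outputPartition (n : ℕ) (s : Memory) : CoalitionStructure n :=
  Finpartition.ofSetoid (Setoid.ker fun i : Fin n => s.nat 2 0 i)

/-- The class `H` (for all numbers of players) is efficiently PAC stabilizable: there are one
program `A` and a sample size `M n ε δ` such that, for every number of players, all `ε, δ > 0`
and every game in `H`,
* the sample size and the running time (on any list of samples) are bounded by a polynomial in
  `n`, `1 / ε` and `log (1 / δ)` (a negative logarithm being replaced by `0`);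
* for every distribution `D`, with probability at least `1 - δ` over `M n ε δ` independent samples
  from `D`, the output is `ε`-PAC stable with respect to `D`, and consists of feasible coalitions.

The program sees only the samples and the utilities of their members for them, not the graph. -/
def EfficientlyPACStabilizable (H : ∀ n : ℕ, Set (HedonicGraphGame n)) : Prop :=
  ∃ (A : Program) (M : ℕ → ℝ → ℝ → ℕ) (C k : ℕ), ∀ (n : ℕ) (ε δ : ℝ), 0 < ε → 0 < δ →
    (M n ε δ : ℝ) ≤ C * (n + 1 / ε + max 0 (Real.log (1 / δ)) + 1) ^ k ∧
    ∀ Γ ∈ H n,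
      (∀ ω : Fin (M n ε δ) → Finset (Fin n),
        ∃ (s : Memory) (t : ℕ), Exec A (inputMemory Γ.utility ε δ ω) s t ∧
          (t : ℝ) ≤ C * (n + 1 / ε + max 0 (Real.log (1 / δ)) + 1) ^ k) ∧
      ∀ D : PMF (Finset (Fin n)),
        1 - δ ≤ sampleProb D (M n ε δ) fun ω =>
          ∃ (s : Memory) (t : ℕ), Exec A (inputMemory Γ.utility ε δ ω) s t ∧
            IsPACStable Γ.utility D ε (outputPartition n s) ∧
            ∀ B ∈ (outputPartition n s).parts, Feasible Γ.graph B

end HedonicPAC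

/-!
The algorithm looks only at the samples, keeps those in which no member has a negative value, and
computes from them a partition into such samples and singletons that no sample blocks.

*Feasibility.* In a game of a forest `G`, a coalition with a member of nonnegative value is connected
in `G`. So the samples without negative values are subtrees of `G`, and any partition into such
samples and singletons is feasible and gives every player a value of at least `0`; in particular, a
sample with a negative value cannot block it.

*Replacing the unknown forest.* The only property of the forest that is needed is an order in which
the players can be eliminated one by one, each player `i` having a neighbour `p` such that every kept
sample that contains `i` and another remaining player contains `p`. Stripping leaves off `G` gives
such an order (`eliminable_of_isAcyclic`), and an exchange argument shows that eliminating any leaf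
leaves a family that can still be eliminated (`Eliminable.erase`). Hence the order can be found
greedily from the samples.

*Stability.* Along this order each player `i` gets a guarantee level: the value of a best coalition
`B i` among `{i}` and the samples consisting of `i` and of players eliminated earlier, each of whom
receives at least its own guarantee level. In the reverse order, every player that has no coalition
yet then receives `B i`. The neighbours of a member `y` of `B i` lead inside `B i` to `i`; therefore
a coalition `B k` that meets `B i`, where `k` is eliminated later, contains `i`
(`GuaranteeState.mem_of_inter`), so that the assigned coalitions are disjoint. Every player gets at
least its guarantee level, and the last eliminated player of a blocking sample would have had a
better choice (`LabelState.stable`).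

*Generalization.* There are at most `2 ^ (n ^ 2)` partitions, and one that is not `ε`-PAC stable
survives `m` samples with probability at most `(1 - ε) ^ m`; a union bound gives the sample size
(`le_sampleProb_of_consistent`).

*Running time.* `Run` is a total-correctness assertion with a bound on the number of steps, with a
rule for counting loops. Tests with bounded quantifiers, such as the one for leaves, are compiled to
nested loops by `allProgram` (`Decides.all`).
-/

namespace HedonicPAC

open Finset

/-! ### Elimination orders of families of subtrees -/

section Elimination

/-- `i` is a leaf with neighbour `p` for the traces on `R` of the family `F`: every member of `F`
that contains `i` and a further element of `R` contains `p`. If `i` meets no other element of `R`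
inside a member of `F`, any `p` in `R` (also `i` itself) will do. -/
def IsLeaf {V : Type*} (F : Set (Finset V)) (R : Finset V) (i p : V) : Prop :=
  i ∈ R ∧ p ∈ R ∧ ∀ S ∈ F, i ∈ S → ∀ z ∈ S, z ∈ R → z ≠ i → p ∈ S ∧ p ≠ i

/-- `R` can be emptied by removing leaves one after the other. -/
inductive Eliminable {V : Type*} [DecidableEq V] (F : Set (Finset V)) : Finset V → Prop
  | empty : Eliminable F ∅
  | step {R : Finset V} {i p : V} : IsLeaf F R i p → Eliminable F (R.erase i) → Eliminable F R

variable {V : Type*} [DecidableEq V] {F : Set (Finset V)}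

/-- Two elements lying in the same nontrivial traces can be exchanged for each other. -/
theorem Eliminable.swap {R : Finset V} (h : Eliminable F R) {i j : V} (hj : j ∈ R) (hi : i ∉ R)
    (hS : ∀ S ∈ F, ∀ x ∈ S, ∀ y ∈ S, x ∈ insert i R → y ∈ insert i R → x ≠ y → (i ∈ S ↔ j ∈ S)) :
    Eliminable F (insert i (R.erase j)) := by
  induction h with
  | empty => simp at hj
  | @step R x p hx hR ih =>
    obtain ⟨hxR, hpR, hleaf⟩ := hx
    have hij : i ≠ j := fun h => hi (h ▸ hj)
    by_cases hxj : x = j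
    · subst hxj
      have hiE : i ∉ R.erase x := fun h => hi (mem_of_mem_erase h)
      refine Eliminable.step (i := i) (p := if p = x then i else p)
        ⟨mem_insert_self _ _, ?_, ?_⟩ (by rwa [erase_insert hiE])
      · split_ifs with hp
        · exact mem_insert_self _ _
        · exact mem_insert_of_mem (mem_erase.2 ⟨hp, hpR⟩)
      · intro S hSF hiS z hzS hzR hzi
        have hzR' : z ∈ R.erase x := by
          rcases mem_insert.1 hzR with h | h
          · exact absurd h hzi
          · exact h
        have hxS : x ∈ S := (hS S hSF i hiS z hzS (mem_insert_self _ _)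
          (mem_insert_of_mem (mem_of_mem_erase hzR')) hzi.symm).1 hiS
        have := hleaf S hSF hxS z hzS (mem_of_mem_erase hzR') (ne_of_mem_erase hzR')
        rw [if_neg this.2]
        exact ⟨this.1, fun h => hi (h ▸ hpR)⟩
    · have hxi : x ≠ i := fun h => hi (h ▸ hxR)
      have hrest : Eliminable F (insert i ((R.erase x).erase j)) := by
        refine ih (mem_erase.2 ⟨fun h => hxj h.symm, hj⟩) (fun h => hi (mem_of_mem_erase h)) ?_
        intro S hSF a ha b hb haR hbR hab
        have hsub : insert i (R.erase x) ⊆ insert i R := insert_subset_insert _ (erase_subset _ _)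
        exact hS S hSF a ha b hb (hsub haR) (hsub hbR) hab
      refine Eliminable.step (i := x) (p := if p = j then i else p)
        ⟨mem_insert_of_mem (mem_erase.2 ⟨hxj, hxR⟩), ?_, ?_⟩ ?_
      · split_ifs with hp
        · exact mem_insert_self _ _
        · exact mem_insert_of_mem (mem_erase.2 ⟨hp, hpR⟩)
      · intro S hSF hxS z hzS hzR hzx
        have hzR' : z ∈ insert i R := insert_subset_insert _ (erase_subset _ _) hzR
        have htw := hS S hSF x hxS z hzS (mem_insert_of_mem hxR) hzR' hzx.symm
        have key : p ∈ S ∧ p ≠ x := by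
          rcases mem_insert.1 hzR' with h | h
          · have hjS : j ∈ S := htw.1 (h ▸ hzS)
            exact hleaf S hSF hxS j hjS hj (fun h => hxj h.symm)
          · exact hleaf S hSF hxS z hzS h hzx
        split_ifs with hp
        · exact ⟨htw.2 (hp ▸ key.1), hxi.symm⟩
        · exact key
      · rwa [erase_insert_of_ne hxi.symm, erase_right_comm]

/-- The leaves can be removed greedily: removing any leaf preserves eliminability. -/
theorem Eliminable.erase {R : Finset V} (h : Eliminable F R) {j q : V} (hj : IsLeaf F R j q) :
    Eliminable F (R.erase j) := by
  induction h generalizing q with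
  | empty => exact absurd hj.1 (by simp)
  | @step R i p hi hR ih =>
    by_cases hij : i = j
    · exact hij ▸ hR
    obtain ⟨hiR, hpR, hleaf⟩ := hi
    obtain ⟨hjR, hqR, hleaf'⟩ := hj
    have hjE : j ∈ R.erase i := mem_erase.2 ⟨fun h => hij h.symm, hjR⟩
    have hiE : i ∈ R.erase j := mem_erase.2 ⟨hij, hiR⟩
    -- `i` stays a leaf after the removal of `j`, unless its neighbour is `j`
    by_cases hqi : q = i
    · subst hqi
      by_cases hpj : p = j
      · -- the two leaves are neighbours of each other, hence interchangeable
        subst hpj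
        have := Eliminable.swap hR (i := q) hjE (notMem_erase _ _) ?_
        · rwa [erase_right_comm, insert_erase hiE] at this
        · intro S hSF x hx y hy hxR hyR hxy
          rw [insert_erase hiR] at hxR hyR
          constructor
          · intro hqS
            by_cases hxq : x = q
            · exact (hleaf S hSF hqS y hy hyR (fun h => hxy (hxq.trans h.symm))).1
            · exact (hleaf S hSF hqS x hx hxR hxq).1
          · intro hpS
            by_cases hxp : x = p
            · exact (hleaf' S hSF hpS y hy hyR (fun h => hxy (hxp.trans h.symm))).1
            · exact (hleaf' S hSF hpS x hx hxR hxp).1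
      · have hE : Eliminable F ((R.erase q).erase j) := by
          by_cases hpq : p = q
          · refine ih (q := j) ⟨hjE, hjE, ?_⟩
            intro S hSF hjS z hzS hzR hzj
            have hqS := (hleaf' S hSF hjS z hzS (mem_of_mem_erase hzR) hzj).1
            exact absurd hpq (hleaf S hSF hqS j hjS hjR (fun h => hij h.symm)).2
          · refine ih (q := p) ⟨hjE, mem_erase.2 ⟨hpq, hpR⟩, ?_⟩
            intro S hSF hjS z hzS hzR hzj
            have hqS := (hleaf' S hSF hjS z hzS (mem_of_mem_erase hzR) hzj).1
            exact ⟨(hleaf S hSF hqS j hjS hjR (fun h => hij h.symm)).1, hpj⟩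
        rw [erase_right_comm] at hE
        refine Eliminable.step (p := p) ⟨hiE, mem_erase.2 ⟨hpj, hpR⟩, ?_⟩ hE
        intro S hSF hqS z hzS hzR hzq
        exact hleaf S hSF hqS z hzS (mem_of_mem_erase hzR) hzq
    · have hE : Eliminable F ((R.erase i).erase j) := by
        refine ih (q := q) ⟨hjE, mem_erase.2 ⟨hqi, hqR⟩, ?_⟩
        intro S hSF hjS z hzS hzR hzj
        exact hleaf' S hSF hjS z hzS (mem_of_mem_erase hzR) hzj
      rw [erase_right_comm] at hE
      by_cases hpj : p = j
      · subst hpj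
        by_cases hqp : q = p
        · refine Eliminable.step (p := i) ⟨hiE, hiE, ?_⟩ hE
          intro S hSF hiS z hzS hzR hzi
          have hpS := (hleaf S hSF hiS z hzS (mem_of_mem_erase hzR) hzi).1
          exact absurd hqp (hleaf' S hSF hpS i hiS hiR hij).2
        · refine Eliminable.step (p := q) ⟨hiE, mem_erase.2 ⟨hqp, hqR⟩, ?_⟩ hE
          intro S hSF hiS z hzS hzR hzi
          have hpS := (hleaf S hSF hiS z hzS (mem_of_mem_erase hzR) hzi).1
          exact ⟨(hleaf' S hSF hpS i hiS hiR hij).1, hqi⟩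
      · refine Eliminable.step (p := p) ⟨hiE, mem_erase.2 ⟨hpj, hpR⟩, ?_⟩ hE
        intro S hSF hiS z hzS hzR hzi
        exact hleaf S hSF hiS z hzS (mem_of_mem_erase hzR) hzi

/-- A nonempty finite forest has a vertex with at most one neighbour. -/
theorem exists_subsingleton_neighbors {W : Type*} [Fintype W] [Nonempty W] {H : SimpleGraph W}
    (hH : H.IsAcyclic) : ∃ x p, ∀ y, H.Adj x y → y = p := by
  classical
  -- the end of a longest path has at most one neighbour
  let P : ℕ → Prop := fun l => ∃ (u v : W) (w : H.Walk u v), w.IsPath ∧ w.length = l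
  have hP0 : P 0 := ⟨Classical.arbitrary W, _, .nil, by simp, rfl⟩
  have hb : ∀ l, P l → l ≤ Fintype.card W := by
    rintro l ⟨u, v, w, hw, rfl⟩
    exact hw.length_lt.le
  obtain ⟨u, v, w, hw, hl⟩ : P (Nat.findGreatest P (Fintype.card W)) :=
    Nat.findGreatest_spec (Nat.zero_le _) hP0
  refine ⟨v, w.penultimate, fun y hy => ?_⟩
  by_cases hys : y ∈ w.support
  · exact hH.eq_penultimate_of_adj_end hw hy hys
  · have hlong : P (w.length + 1) := ⟨u, y, w.concat hy, hw.concat hys hy, by simp⟩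
    have := Nat.le_findGreatest (hb _ hlong) hlong
    omega

/-- Connectedness of a vertex set in terms of cuts. -/
def CutConnected (G : SimpleGraph V) (S : Finset V) : Prop :=
  ∀ A ⊆ S, A.Nonempty → A ≠ S → ∃ a ∈ A, ∃ b ∈ S, b ∉ A ∧ G.Adj a b

theorem cutConnected_of_connected {G : SimpleGraph V} {S : Finset V}
    (h : (G.induce (S : Set V)).Connected) : CutConnected G S := by
  rintro A hAS ⟨a, ha⟩ hne
  obtain ⟨b, hbS, hbA⟩ : ∃ b ∈ S, b ∉ A := by
    by_contra! hcon
    exact hne (hAS.antisymm hcon)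
  obtain ⟨w⟩ := h.preconnected ⟨a, hAS ha⟩ ⟨b, hbS⟩
  obtain ⟨d, -, hd1, hd2⟩ := w.exists_boundary_dart {x | (x : V) ∈ A} ha hbA
  exact ⟨d.fst, hd1, d.snd, d.snd.2, hd2, d.adj⟩

/-- Removing a vertex with at most one neighbour keeps a vertex set connected. -/
theorem CutConnected.erase {G : SimpleGraph V} {S : Finset V} (h : CutConnected G S) {i p : V}
    (hp : ∀ y ∈ S, G.Adj i y → y = p) : CutConnected G (S.erase i) := by
  by_cases hiS : i ∈ S
  swap
  · rwa [erase_eq_of_notMem hiS]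
  intro A hAS hA hne
  have hiA : i ∉ A := fun hi => notMem_erase _ _ (hAS hi)
  have hAS' : A ⊆ S := hAS.trans (erase_subset _ _)
  by_cases hpA : p ∈ A
  · obtain ⟨a, ha, b, hb, hbA, hab⟩ := h (insert i A) (insert_subset hiS hAS')
      (insert_nonempty _ _) (fun heq => hne (by rw [← heq, erase_insert hiA]))
    simp only [mem_insert, not_or] at ha hbA
    rcases ha with rfl | ha
    · exact absurd (hp b hb hab ▸ hpA) hbA.2
    · exact ⟨a, ha, b, mem_erase.2 ⟨hbA.1, hb⟩, hbA.2, hab⟩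
  · obtain ⟨a, ha, b, hb, hbA, hab⟩ := h A hAS' hA (fun heq => hiA (heq ▸ hiS))
    refine ⟨a, ha, b, mem_erase.2 ⟨?_, hb⟩, hbA, hab⟩
    rintro rfl
    exact hpA (hp a (hAS' ha) hab.symm ▸ ha)

/-- A family of connected vertex sets of a forest is eliminable. -/
theorem eliminable_of_isAcyclic {G : SimpleGraph V} (hG : G.IsAcyclic) (R : Finset V)
    (hF : ∀ S ∈ F, CutConnected G (S ∩ R)) : Eliminable F R := by
  induction hc : R.card generalizing R with
  | zero => rw [card_eq_zero] at hc; subst hc; exact .empty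
  | succ c ih =>
    have hne : R.Nonempty := card_pos.1 (by omega)
    have : Nonempty (R : Set V) := hne.to_subtype
    obtain ⟨⟨i, hiR⟩, ⟨p, hpR⟩, hp⟩ := exists_subsingleton_neighbors (hG.induce (R : Set V))
    have hp' : ∀ y ∈ R, G.Adj i y → y = p := fun y hy hadj =>
      congrArg Subtype.val (hp ⟨y, hy⟩ hadj)
    have hiR' : i ∈ R := hiR
    refine .step (i := i) (p := p) ⟨hiR, hpR, ?_⟩ (ih _ ?_ ?_)
    · intro S hSF hiS z hzS hzR hzi
      obtain ⟨a, ha, b, hb, hbi, hab⟩ := hF S hSF {i}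
        (by simpa using ⟨hiS, hiR'⟩) (singleton_nonempty i) (fun h => hzi (by
          have : z ∈ S ∩ R := mem_inter.2 ⟨hzS, hzR⟩
          rw [← h] at this
          simpa using this))
      rw [mem_singleton] at ha hbi
      subst ha
      obtain rfl := hp' b (mem_inter.1 hb).2 hab
      exact ⟨(mem_inter.1 hb).1, hbi⟩
    · intro S hSF
      rw [inter_erase]
      exact (hF S hSF).erase fun y hy hadj => hp' y (mem_inter.1 hy).2 hadj
    · rw [card_erase_of_mem hiR']; omega

end Elimination

/-! ### Guarantee levels along an elimination order -/

section Guarantee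

variable {n : ℕ} (v : HedonicGame n)

/-- The sampled coalitions with no negative value for any member. -/
def nonnegative (Smp : Set (Finset (Fin n))) : Set (Finset (Fin n)) :=
  {S | S ∈ Smp ∧ ∀ z ∈ S, 0 ≤ v z S}

/-- Among the coalitions in `Smp` that consist of `i` and of players that have a rank, and that give
each of the latter at least its guarantee level `g`, the coalition `B` is a best one for `i`; its
value for `i` is `g i`. The fallback is the singleton. -/
structure IsBest (rank : Fin n → ℕ) (g : Fin n → ℝ) (i : Fin n) (Smp : Set (Finset (Fin n)))
    (B : Finset (Fin n)) : Prop where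
  mem : i ∈ B
  nonneg : 0 ≤ g i
  eq : (B = {i} ∧ g i = 0) ∨ (B ∈ Smp ∧ v i B = g i)
  prior : ∀ z ∈ B, z ≠ i → rank z ≠ 0 ∧ g z ≤ v z B
  max : ∀ S ∈ Smp, i ∈ S → (∀ z ∈ S, z ≠ i → rank z ≠ 0 ∧ g z ≤ v z S) → v i S ≤ g i

/-- The state after `t` eliminations. The ranks `n, n - 1, …` are given out in the order of
elimination, rank `0` meaning not yet eliminated, so that "eliminated later, or not yet" is always
"of smaller rank". The player of rank `k` is `order k`, and `B i` is the coalition that realizes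
the guarantee level `g i`. -/
structure GuaranteeState (Smp : Set (Finset (Fin n))) (t : ℕ) (rank order : Fin n → ℕ)
    (B : Fin n → Finset (Fin n)) (g : Fin n → ℝ) : Prop where
  rank_lt : ∀ i, rank i ≠ 0 → n - t < rank i
  rank_le : ∀ i, rank i ≤ n
  order_rank : ∀ i, ∀ k : Fin n, rank i = k + 1 → order k = i
  card : #{i | rank i = 0} = n - t
  elim : Eliminable (nonnegative v Smp) {i | rank i = 0}
  mem : ∀ i, i ∈ B i
  fresh : ∀ i, rank i = 0 → B i = {i} ∧ g i = 0
  nonneg : ∀ i, 0 ≤ g i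
  source : ∀ i, B i = {i} ∨ B i ∈ nonnegative v Smp
  top : ∀ i, ∀ z ∈ B i, z ≠ i → rank i < rank z
  level : ∀ i, ∀ z ∈ B i, g z ≤ v z (B i)
  leaf : ∀ i, rank i ≠ 0 → ∃ p, ∀ S ∈ nonnegative v Smp, i ∈ S → ∀ z ∈ S, rank z < rank i →
    p ∈ S ∧ rank p < rank i
  max : ∀ i, rank i ≠ 0 → ∀ S ∈ Smp, i ∈ S →
    (∀ z ∈ S, z ≠ i → rank i < rank z ∧ g z ≤ v z S) → v i S ≤ g i

variable {v}

theorem IsBest.insert_of_pass {rank : Fin n → ℕ} {g : Fin n → ℝ} {i : Fin n}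
    {Smp : Set (Finset (Fin n))} {B S : Finset (Fin n)} (h : IsBest v rank g i Smp B) (hi : i ∈ S)
    (hS : ∀ z ∈ S, (z = i ∨ rank z ≠ 0) ∧ g z ≤ v z S) :
    IsBest v rank (Function.update g i (v i S)) i (insert S Smp) S where
  mem := hi
  nonneg := by simpa using h.nonneg.trans (hS i hi).2
  eq := by simp
  prior z hz hzi := by
    rw [Function.update_of_ne hzi]
    exact ⟨(hS z hz).1.resolve_left hzi, (hS z hz).2⟩
  max T hT hiT hzT := by
    rw [Function.update_self]
    rcases hT with rfl | hT
    · exact le_rfl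
    · refine (h.max T hT hiT fun z hz hzi => ?_).trans (hS i hi).2
      have := hzT z hz hzi
      rwa [Function.update_of_ne hzi] at this

theorem IsBest.insert_of_fail {rank : Fin n → ℕ} {g : Fin n → ℝ} {i : Fin n}
    {Smp : Set (Finset (Fin n))} {B S : Finset (Fin n)} (h : IsBest v rank g i Smp B)
    (hS : ¬ (i ∈ S ∧ ∀ z ∈ S, (z = i ∨ rank z ≠ 0) ∧ g z ≤ v z S)) :
    IsBest v rank g i (insert S Smp) B where
  mem := h.mem
  nonneg := h.nonneg
  eq := h.eq.imp_right fun h => ⟨Or.inr h.1, h.2⟩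
  prior := h.prior
  max T hT hiT hzT := by
    rcases hT with rfl | hT
    · by_contra! hlt
      refine hS ⟨hiT, fun z hz => ?_⟩
      by_cases hzi : z = i
      · exact ⟨Or.inl hzi, hzi ▸ hlt.le⟩
      · exact ⟨Or.inr (hzT z hz hzi).1, (hzT z hz hzi).2⟩
    · exact h.max T hT hiT hzT

variable {Smp : Set (Finset (Fin n))} {t : ℕ} {rank order : Fin n → ℕ}
  {B : Fin n → Finset (Fin n)} {g : Fin n → ℝ}

theorem GuaranteeState.start (hv : ∀ i, v i {i} = 0)
    (hE : Eliminable (nonnegative v Smp) univ) :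
    GuaranteeState v Smp 0 (fun _ => 0) order (fun i => {i}) fun _ => 0 where
  rank_lt i h := absurd rfl h
  rank_le i := Nat.zero_le _
  order_rank i k h := by simp at h
  card := by simp
  elim := by simpa using hE
  mem i := mem_singleton_self i
  fresh i _ := ⟨rfl, rfl⟩
  nonneg i := le_rfl
  source i := Or.inl rfl
  top i z hz hzi := absurd (mem_singleton.1 hz) hzi
  level i z hz := by obtain rfl := mem_singleton.1 hz; exact (hv z).ge
  leaf i h := absurd rfl h
  max i h := absurd rfl h

/-- As long as a player is left there is a leaf. -/
theorem GuaranteeState.exists_leaf (h : GuaranteeState v Smp t rank order B g) (ht : t < n) :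
    ∃ i p, IsLeaf (nonnegative v Smp) ({i | rank i = 0} : Finset (Fin n)) i p := by
  have hE := h.elim
  have hc := h.card
  generalize ({i | rank i = 0} : Finset (Fin n)) = R at hE hc
  cases hE with
  | empty => simp at hc; omega
  | step hl _ => exact ⟨_, _, hl⟩

/-- Eliminating a leaf, with a best coalition for it. -/
theorem GuaranteeState.step (h : GuaranteeState v Smp t rank order B g) (ht : t < n) {i p : Fin n}
    (hl : IsLeaf (nonnegative v Smp) ({i | rank i = 0} : Finset (Fin n)) i p) {g' : Fin n → ℝ}
    (hg' : ∀ z, z ≠ i → g' z = g z) {B' : Finset (Fin n)} (hB : IsBest v rank g' i Smp B')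
    (hv : v i {i} = 0) :
    GuaranteeState v Smp (t + 1) (Function.update rank i (n - t))
      (Function.update order ⟨n - t - 1, by omega⟩ i) (Function.update B i B') g' := by
  obtain ⟨hi, hp, hleaf⟩ := hl
  simp only [mem_filter, mem_univ, true_and] at hi hp hleaf
  have hlev : ∀ z ∈ B', g' z ≤ v z B' := by
    intro z hz
    by_cases hzi : z = i
    · subst hzi
      rcases hB.eq with ⟨rfl, h0⟩ | ⟨-, h1⟩
      · rw [h0, hv]
      · exact h1.ge
    · exact (hB.prior z hz hzi).2
  have hnn : ∀ z, 0 ≤ g' z := by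
    intro z
    by_cases hzi : z = i
    · exact hzi ▸ hB.nonneg
    · rw [hg' z hzi]; exact h.nonneg z
  -- a coalition chosen earlier contains `i` only if it is the singleton chosen for `i` itself
  have hni : ∀ k, k ≠ i → i ∉ B k := fun k hk hik => by
    have := h.top k i hik hk.symm
    omega
  have hset : ({j | Function.update rank i (n - t) j = 0} : Finset (Fin n)) =
      ({j | rank j = 0} : Finset (Fin n)).erase i := by
    ext j
    by_cases hji : j = i
    · subst hji; simp; omega
    · simp [hji]
  have hrk : ∀ z, z ≠ i → Function.update rank i (n - t) z = rank z :=
    fun z hz => Function.update_of_ne hz _ _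
  have hri : Function.update rank i (n - t) i = n - t := Function.update_self _ _ _
  refine ⟨?_, ?_, ?_, ?_, ?_, ?_, ?_, hnn, ?_, ?_, ?_, ?_, ?_⟩
  · intro j hj
    by_cases hji : j = i
    · subst hji; rw [hri]; omega
    · rw [hrk j hji] at hj ⊢
      have := h.rank_lt j hj
      omega
  · intro j
    by_cases hji : j = i
    · subst hji; rw [hri]; omega
    · rw [hrk j hji]; exact h.rank_le j
  · intro j k hjk
    by_cases hji : j = i
    · subst hji
      rw [hri] at hjk
      have : k = ⟨n - t - 1, by omega⟩ := Fin.ext (by simp; omega)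
      rw [this, Function.update_self]
    · rw [hrk j hji] at hjk
      have := h.rank_lt j (by omega)
      rw [Function.update_of_ne, h.order_rank j k hjk]
      intro hk
      rw [hk] at hjk
      simp at hjk
      omega
  · rw [hset, card_erase_of_mem (by simpa using hi), h.card]
    omega
  · rw [hset]
    exact h.elim.erase ⟨by simpa using hi, by simpa using hp, by simpa using hleaf⟩
  · intro j
    by_cases hji : j = i
    · subst hji; rw [Function.update_self]; exact hB.mem
    · rw [Function.update_of_ne hji]; exact h.mem j
  · intro j hj
    by_cases hji : j = i
    · subst hji; rw [hri] at hj; omega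
    · rw [hrk j hji] at hj
      rw [Function.update_of_ne hji, hg' j hji]; exact h.fresh j hj
  · intro j
    by_cases hji : j = i
    · subst hji
      rw [Function.update_self]
      exact hB.eq.imp (fun h => h.1) fun h => ⟨h.1, fun z hz => (hnn z).trans (hlev z hz)⟩
    · rw [Function.update_of_ne hji]; exact h.source j
  · intro j z hz hzj
    by_cases hji : j = i
    · subst hji
      rw [Function.update_self] at hz
      rw [hri, hrk z hzj]
      have := h.rank_lt z (hB.prior z hz hzj).1
      omega
    · rw [Function.update_of_ne hji] at hz
      rw [hrk j hji, hrk z fun h => hni j hji (h ▸ hz)]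
      exact h.top j z hz hzj
  · intro j z hz
    by_cases hji : j = i
    · subst hji
      rw [Function.update_self] at hz ⊢
      exact hlev z hz
    · rw [Function.update_of_ne hji] at hz ⊢
      rw [hg' z fun h => hni j hji (h ▸ hz)]
      exact h.level j z hz
  · intro j hj
    by_cases hji : j = i
    · subst hji
      refine ⟨p, fun S hS hjS z hz hzr => ?_⟩
      have hzj : z ≠ j := fun h => by subst h; omega
      rw [hri, hrk z hzj] at hzr
      have hz0 : rank z = 0 := by
        by_contra hz0
        have := h.rank_lt z hz0
        omega
      obtain ⟨hpS, hpj⟩ := hleaf S hS hjS z hz hz0 hzj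
      refine ⟨hpS, ?_⟩
      rw [hri, hrk p hpj]
      omega
    · rw [hrk j hji] at hj ⊢
      obtain ⟨q, hq⟩ := h.leaf j hj
      have hjt := h.rank_lt j hj
      refine ⟨q, fun S hS hjS z hz hzr => ?_⟩
      have hz' : rank z < rank j := by
        by_cases hzi : z = i
        · subst hzi; omega
        · rwa [hrk z hzi] at hzr
      refine ⟨(hq S hS hjS z hz hz').1, ?_⟩
      by_cases hqi : q = i
      · subst hqi; rw [hri]; omega
      · rw [hrk q hqi]; exact (hq S hS hjS z hz hz').2
  · intro j hj S hS hjS hzS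
    by_cases hji : j = i
    · subst hji
      refine hB.max S hS hjS fun z hz hzj => ?_
      have := hzS z hz hzj
      rw [hri, hrk z hzj] at this
      exact ⟨by omega, this.2⟩
    · rw [hrk j hji] at hj hzS
      rw [hg' j hji]
      have hjt := h.rank_lt j hj
      refine h.max j hj S hS hjS fun z hz hzj => ?_
      have := hzS z hz hzj
      by_cases hzi : z = i
      · subst hzi
        rw [hri] at this
        omega
      · rw [hrk z hzi, hg' z hzi] at this
        exact this

theorem GuaranteeState.rank_ne_zero (h : GuaranteeState v Smp n rank order B g) (i : Fin n) :
    rank i ≠ 0 := by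
  have := h.card
  rw [Nat.sub_self, card_eq_zero, filter_eq_empty_iff] at this
  exact this (mem_univ i)

theorem GuaranteeState.rank_injective (h : GuaranteeState v Smp n rank order B g) :
    Function.Injective rank := by
  intro i j hij
  have h1 := h.rank_ne_zero i
  have h2 := h.rank_le i
  have e1 := h.order_rank i ⟨rank i - 1, by omega⟩ (by simp; omega)
  have e2 := h.order_rank j ⟨rank i - 1, by omega⟩ (by simp; omega)
  exact Fin.ext (e1.symm.trans e2)

/-- Every rank is taken, and `order` finds its player. -/
theorem GuaranteeState.exists_order (h : GuaranteeState v Smp n rank order B g) (k : Fin n) :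
    ∃ i : Fin n, order k = i ∧ rank i = k + 1 := by
  let f : Fin n → Fin n := fun i => ⟨rank i - 1, by
    have := h.rank_ne_zero i
    have := h.rank_le i
    omega⟩
  have hf : Function.Injective f := by
    intro i j hij
    have h1 := h.rank_ne_zero i
    have h2 := h.rank_ne_zero j
    have h3 : rank i - 1 = rank j - 1 := congrArg Fin.val hij
    exact h.rank_injective (by omega)
  obtain ⟨i, hi⟩ := (Finite.injective_iff_surjective.1 hf) k
  have h1 := h.rank_ne_zero i
  have h3 : rank i - 1 = k := congrArg Fin.val hi
  exact ⟨i, h.order_rank i k (by omega), by omega⟩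

/-- If the coalition chosen for `i` meets the one chosen for a later `k`, it does so in `i`: from a
common member, the chain of neighbours stays in both coalitions until it reaches `i`. -/
theorem GuaranteeState.mem_of_inter (h : GuaranteeState v Smp n rank order B g) {i k y : Fin n}
    (hik : rank k < rank i) (hyi : y ∈ B i) (hyk : y ∈ B k) : i ∈ B k := by
  induction hd : rank y using Nat.strong_induction_on generalizing y with
  | _ d ih =>
    by_cases hy : y = i
    · exact hy ▸ hyk
    have hlt := h.top i y hyi hy
    have hyk' : y ≠ k := fun e => by subst e; omega
    have hBi := (h.source i).resolve_left fun e => hy (by simpa [e] using hyi)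
    have hBk := (h.source k).resolve_left fun e => hyk' (by simpa [e] using hyk)
    obtain ⟨p, hp⟩ := h.leaf y (h.rank_ne_zero y)
    obtain ⟨hpi, hpr⟩ := hp _ hBi hyi i (h.mem i) hlt
    obtain ⟨hpk, -⟩ := hp _ hBk hyk k (h.mem k) (by omega)
    exact ih (rank p) (by omega) hpi hpk rfl

/-- The players of rank at most `t` have been assigned coalitions, in the order of increasing rank:
`label x = k + 1` puts `x` into the coalition `B k`, and `label x = 0` means unassigned. -/
structure LabelState (t : ℕ) (rank : Fin n → ℕ) (B : Fin n → Finset (Fin n))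
    (label : Fin n → ℕ) : Prop where
  assigned : ∀ x, rank x ≤ t → label x ≠ 0
  label_eq : ∀ x, label x ≠ 0 → ∃ k : Fin n, label x = k + 1
  coalition : ∀ x, ∀ k : Fin n, label x = k + 1 → x ∈ B k ∧ rank k ≤ t ∧ ∀ y ∈ B k, label y = k + 1

theorem LabelState.start (h : ∀ x, rank x ≠ 0) : LabelState 0 rank B fun _ => 0 where
  assigned x hx := absurd (Nat.le_zero.1 hx) (h x)
  label_eq x hx := absurd rfl hx
  coalition x k hk := by simp at hk

theorem LabelState.step_assigned (h : GuaranteeState v Smp n rank order B g) {label : Fin n → ℕ}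
    (hL : LabelState t rank B label) {i : Fin n} (hi : rank i = t + 1) (hli : label i ≠ 0) :
    LabelState (t + 1) rank B label where
  assigned x hx := by
    rcases Nat.lt_or_ge t (rank x) with hlt | hle
    · rwa [h.rank_injective (a₁ := x) (a₂ := i) (by omega)]
    · exact hL.assigned x hle
  label_eq := hL.label_eq
  coalition x k hk := by
    obtain ⟨h1, h2, h3⟩ := hL.coalition x k hk
    exact ⟨h1, by omega, h3⟩

theorem LabelState.step_new (h : GuaranteeState v Smp n rank order B g) {label : Fin n → ℕ}
    (hL : LabelState t rank B label) {i : Fin n} (hi : rank i = t + 1) (hli : label i = 0) :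
    LabelState (t + 1) rank B fun x => if x ∈ B i then i + 1 else label x := by
  have hfree : ∀ y ∈ B i, label y = 0 := by
    intro y hy
    by_contra hly
    obtain ⟨k, hk⟩ := hL.label_eq y hly
    obtain ⟨h1, h2, h3⟩ := hL.coalition y k hk
    have := h3 i (h.mem_of_inter (by omega) hy h1)
    omega
  refine ⟨fun x hx => ?_, fun x hx => ?_, fun x k hk => ?_⟩
  · split_ifs with hxi
    · omega
    · rcases Nat.lt_or_ge t (rank x) with hlt | hle
      · exact absurd (h.rank_injective (a₁ := x) (a₂ := i) (by omega) ▸ h.mem i) hxi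
      · exact hL.assigned x hle
  · split_ifs at hx ⊢ with hxi
    · exact ⟨i, rfl⟩
    · exact hL.label_eq x hx
  · split_ifs at hk with hxi
    · obtain rfl : i = k := Fin.ext (by omega)
      exact ⟨hxi, by omega, fun y hy => if_pos hy⟩
    · obtain ⟨h1, h2, h3⟩ := hL.coalition x k hk
      refine ⟨h1, by omega, fun y hy => ?_⟩
      have := h3 y hy
      rw [if_neg fun hyi => ?_]
      · exact this
      · have := hfree y hyi
        omega

/-- If the classes of `π` are the chosen coalitions, `π` is feasible and blocked by no sample: the
last eliminated player of a blocking sample would have had a higher guarantee level. -/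
theorem LabelState.stable (h : GuaranteeState v Smp n rank order B g) {label : Fin n → ℕ}
    (hL : LabelState n rank B label) {G : SimpleGraph (Fin n)} (hv : v ∈ gamesOn G)
    {π : CoalitionStructure n} (hπ : ∀ x y, y ∈ π.part x ↔ label x = label y) :
    (∀ S ∈ Smp, ¬ StronglyBlocks v π S) ∧ ∀ P ∈ π.parts, Feasible G P := by
  have hpart : ∀ x, ∃ k, π.part x = B k ∧ x ∈ B k := by
    intro x
    obtain ⟨k, hk⟩ := hL.label_eq x (hL.assigned x (h.rank_le x))
    obtain ⟨hx, -, hall⟩ := hL.coalition x k hk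
    refine ⟨k, ?_, hx⟩
    ext y
    rw [hπ, hk]
    exact ⟨fun hy => (hL.coalition y k hy.symm).1, fun hy => (hall y hy).symm⟩
  refine ⟨?_, ?_⟩
  · rintro S hS ⟨hne, hblock⟩
    have hg : ∀ z ∈ S, g z < v z S := fun z hz => by
      obtain ⟨k, hk, hzk⟩ := hpart z
      exact (hk ▸ h.level k z hzk).trans_lt (hblock z hz)
    obtain ⟨i, hi, hmin⟩ := S.exists_min_image rank hne
    refine (hg i hi).not_ge (h.max i (h.rank_ne_zero i) S hS hi fun z hz hzi => ⟨?_, (hg z hz).le⟩)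
    exact lt_of_le_of_ne (hmin z hz) fun e => hzi (h.rank_injective e).symm
  · intro P hP
    obtain ⟨x, hx⟩ := π.nonempty_of_mem_parts hP
    rw [← π.part_eq_of_mem hP hx]
    obtain ⟨k, hk, -⟩ := hpart x
    rw [hk]
    by_contra hnot
    refine ((hv k).2 _ (h.mem k) hnot).not_ge ?_
    exact (h.nonneg k).trans (h.level k k (h.mem k))

/-- In a game of a forest, the samples without negative values are eliminable. -/
theorem eliminable_nonnegative {G : SimpleGraph (Fin n)} (hG : G.IsAcyclic) (hv : v ∈ gamesOn G)
    (Smp : Set (Finset (Fin n))) : Eliminable (nonnegative v Smp) univ := by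
  refine eliminable_of_isAcyclic hG _ fun S hS => ?_
  rw [inter_univ]
  rcases S.eq_empty_or_nonempty with rfl | ⟨i, hi⟩
  · intro A hA hne
    exact absurd (subset_empty.1 hA) hne.ne_empty
  · refine cutConnected_of_connected ?_
    by_contra hnot
    exact ((hv i).2 S hi hnot).not_ge (hS.2 i hi)

end Guarantee

/-! ### Consistent partitions generalize -/

section Probability

variable {n : ℕ}

theorem sum_toReal_eq_one (D : PMF (Finset (Fin n))) : ∑ S, (D S).toReal = 1 := by
  rw [← ENNReal.toReal_sum fun S _ => D.apply_ne_top S, ← tsum_fintype (L := .unconditional _),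
    D.tsum_coe, ENNReal.toReal_one]

open Classical in
theorem sum_prod_forall (D : PMF (Finset (Fin n))) (m : ℕ) (E : Finset (Fin n) → Prop) :
    ∑ ω : Fin m → Finset (Fin n) with ∀ j, E (ω j), ∏ j, (D (ω j)).toReal = prob D E ^ m := by
  have h := sum_prod_piFinset (ι := Fin m) ({S | E S} : Finset (Finset (Fin n)))
    fun _ S => (D S).toReal
  rw [prod_const, card_univ, Fintype.card_fin] at h
  rw [prob, ← h]
  refine sum_congr ?_ fun _ _ => rfl
  ext ω
  simp [Fintype.mem_piFinset]

theorem prob_not (D : PMF (Finset (Fin n))) (E : Finset (Fin n) → Prop) :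
    prob D (fun S => ¬ E S) = 1 - prob D E := by
  classical
  have := sum_filter_add_sum_filter_not univ E fun S => (D S).toReal
  rw [sum_toReal_eq_one] at this
  unfold prob
  convert eq_sub_of_add_eq' this

theorem prob_nonneg (D : PMF (Finset (Fin n))) (E : Finset (Fin n) → Prop) : 0 ≤ prob D E :=
  sum_nonneg fun _ _ => ENNReal.toReal_nonneg

theorem sampleProb_nonneg (D : PMF (Finset (Fin n))) (m : ℕ)
    (E : (Fin m → Finset (Fin n)) → Prop) : 0 ≤ sampleProb D m E :=
  sum_nonneg fun _ _ => prod_nonneg fun _ _ => ENNReal.toReal_nonneg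

/-- A partition is determined by its equivalence relation. -/
theorem card_coalitionStructure_le (n : ℕ) :
    Fintype.card (CoalitionStructure n) ≤ 2 ^ (n ^ 2) := by
  classical
  let f : CoalitionStructure n → Finset (Fin n × Fin n) := fun π => {x | x.2 ∈ π.part x.1}
  have hf : Function.Injective f := by
    intro π σ h
    have hpart : ∀ i, π.part i = σ.part i := fun i => by
      ext j
      simpa [f] using congrArg ((i, j) ∈ ·) h
    ext P
    constructor
    · intro hP
      obtain ⟨x, hx⟩ := π.nonempty_of_mem_parts hP
      rw [← π.part_eq_of_mem hP hx, hpart]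
      exact σ.part_mem.2 (mem_univ x)
    · intro hP
      obtain ⟨x, hx⟩ := σ.nonempty_of_mem_parts hP
      rw [← σ.part_eq_of_mem hP hx, ← hpart]
      exact π.part_mem.2 (mem_univ x)
  refine (Fintype.card_le_of_injective f hf).trans ?_
  rw [Fintype.card_finset, Fintype.card_prod, Fintype.card_fin, sq]

/-- If on every sample some partition is blocked by no sampled coalition, and its stability
implies `E`, then `E` has probability at least `1 - δ`: a union bound over all partitions. -/
theorem le_sampleProb_of_consistent (v : HedonicGame n) (D : PMF (Finset (Fin n))) {m : ℕ}
    {ε δ : ℝ} (hε : 0 < ε) (hδ : 0 < δ)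
    (hm : ((n : ℝ) ^ 2 + max 0 (Real.log (1 / δ))) / ε ≤ m)
    (E : (Fin m → Finset (Fin n)) → Prop)
    (hE : ∀ ω, ∃ π : CoalitionStructure n, (∀ j, ¬ StronglyBlocks v π (ω j)) ∧
      (IsPACStable v D ε π → E ω)) :
    1 - δ ≤ sampleProb D m E := by
  classical
  rcases le_or_gt 1 δ with h1 | h1
  · exact (sub_nonpos.2 h1).trans (sampleProb_nonneg D m E)
  let w : (Fin m → Finset (Fin n)) → ℝ := fun ω => ∏ j, (D (ω j)).toReal
  have hw : ∀ ω, 0 ≤ w ω := fun ω => prod_nonneg fun _ _ => ENNReal.toReal_nonneg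
  have htotal : sampleProb D m E + ∑ ω with ¬ E ω, w ω = 1 := by
    have h2 := sum_filter_add_sum_filter_not univ E w
    have h3 := sum_prod_piFinset (ι := Fin m) univ fun _ S => (D S).toReal
    rw [Fintype.piFinset_univ, sum_toReal_eq_one, prod_const_one] at h3
    rw [← h3, ← h2]
    unfold sampleProb
    congr!
  have hlog : Real.log (1 / δ) = -Real.log δ := by rw [one_div, Real.log_inv]
  have hexp : Real.exp (-ε * m) ≤ Real.exp (-(n : ℝ) ^ 2) * δ := by
    rw [← Real.exp_log hδ]
    rw [← Real.exp_add, Real.exp_le_exp]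
    rw [div_le_iff₀ hε] at hm
    have := le_max_right 0 (Real.log (1 / δ))
    rw [hlog] at this hm
    linarith
  have hbad : ∑ ω with ¬ E ω, w ω ≤ δ := calc
    ∑ ω with ¬ E ω, w ω
      ≤ ∑ ω, ∑ π with ε ≤ prob D (StronglyBlocks v π),
          if ∀ j, ¬ StronglyBlocks v π (ω j) then w ω else 0 := by
        rw [sum_filter]
        refine sum_le_sum fun ω _ => ?_
        have hnn : ∀ π : CoalitionStructure n,
            0 ≤ if ∀ j, ¬ StronglyBlocks v π (ω j) then w ω else 0 := fun π => by
          split_ifs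
          · exact hw ω
          · exact le_rfl
        split_ifs with hω
        · exact sum_nonneg fun π _ => hnn π
        · obtain ⟨π, hπ, hst⟩ := hE ω
          refine le_trans (if_pos hπ).ge (single_le_sum
            (f := fun π => if ∀ j, ¬ StronglyBlocks v π (ω j) then w ω else 0)
            (fun σ _ => hnn σ) ?_)
          rw [mem_filter]
          exact ⟨mem_univ π, not_lt.1 fun hlt => hω (hst hlt)⟩
    _ = ∑ π with ε ≤ prob D (StronglyBlocks v π),
          ∑ ω with ∀ j, ¬ StronglyBlocks v π (ω j), w ω := by
        rw [sum_comm]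
        exact sum_congr rfl fun π _ => (sum_filter _ _).symm
    _ ≤ ∑ π : CoalitionStructure n with ε ≤ prob D (StronglyBlocks v π), Real.exp (-ε * m) := by
        refine sum_le_sum fun π hπ => ?_
        simp only [mem_filter, mem_univ, true_and] at hπ
        have h := sum_prod_forall D m fun S => ¬ StronglyBlocks v π S
        rw [prob_not] at h
        have h0 := prob_nonneg D fun S => ¬ StronglyBlocks v π S
        rw [prob_not] at h0
        have h5 : (1 - prob D (StronglyBlocks v π)) ^ m ≤ Real.exp (-ε * m) := by
          rw [mul_comm, Real.exp_nat_mul]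
          refine pow_le_pow_left₀ h0 ?_ m
          have := Real.add_one_le_exp (-ε)
          linarith
        refine le_trans (le_of_eq ?_) h5
        rw [← h]
        exact sum_congr (by ext; simp) fun _ _ => rfl
    _ ≤ 2 ^ (n ^ 2) * Real.exp (-ε * m) := by
        rw [sum_const, nsmul_eq_mul]
        refine mul_le_mul_of_nonneg_right ?_ (Real.exp_pos _).le
        have := (card_filter_le univ fun π => ε ≤ prob D (StronglyBlocks v π)).trans
          (card_coalitionStructure_le n)
        exact_mod_cast this
    _ ≤ Real.exp ((n : ℝ) ^ 2) * (Real.exp (-(n : ℝ) ^ 2) * δ) := by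
        refine mul_le_mul ?_ hexp (Real.exp_pos _).le (Real.exp_pos _).le
        have h2 : (2 : ℝ) ≤ Real.exp 1 := by have := Real.add_one_le_exp (1 : ℝ); linarith
        calc (2 : ℝ) ^ (n ^ 2) ≤ Real.exp 1 ^ (n ^ 2) := pow_le_pow_left₀ (by norm_num) h2 _
          _ = Real.exp ((n : ℝ) ^ 2) := by rw [← Real.exp_nat_mul]; push_cast; rw [mul_one]
    _ = δ := by rw [← mul_assoc, ← Real.exp_add, add_neg_cancel, Real.exp_zero, one_mul]
  linarith

end Probability

/-! ### Reasoning about programs -/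

section Logic

/-- Started in `s`, the program `c` halts after at most `T` steps in a memory satisfying `Q`. -/
def Run (c : Program) (s : Memory) (T : ℕ) (Q : Memory → Prop) : Prop :=
  ∃ s' t, Exec c s s' t ∧ t ≤ T ∧ Q s'

variable {c d : Program} {s : Memory} {T U : ℕ} {Q R : Memory → Prop}

theorem Run.mono (h : Run c s T Q) (hQ : ∀ s', Q s' → R s') (hT : T ≤ U) : Run c s U R := by
  obtain ⟨s', t, he, ht, hs⟩ := h
  exact ⟨s', t, he, ht.trans hT, hQ s' hs⟩

theorem Run.skip (h : Q s) : Run .skip s 1 Q := ⟨s, 1, .skip s, le_rfl, h⟩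

theorem Run.assign {a : ℕ} {i j e : Expr} (h : Q (s.setNat a (i.eval s) (j.eval s) (e.eval s))) :
    Run (.assign a i j e) s 1 Q := ⟨_, 1, .assign s a i j e, le_rfl, h⟩

theorem Run.copy {x y : RealCell}
    (h : Q (s.setReal x.name (x.row.eval s) (x.col.eval s) (y.eval s))) :
    Run (.copy x y) s 1 Q := ⟨_, 1, .copy s x y, le_rfl, h⟩

theorem Run.seq {W : ℕ} (h : Run c s T Q) (h' : ∀ s', Q s' → Run d s' U R) (hW : T + U ≤ W) :
    Run (.seq c d) s W R := by
  obtain ⟨s', t, he, ht, hs⟩ := h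
  obtain ⟨s'', u, he', hu, hs'⟩ := h' s' hs
  exact ⟨s'', t + u, .seq he he', by omega, hs'⟩

theorem Run.ite {b : Test} (h : b.Holds s → Run c s T Q) (h' : ¬ b.Holds s → Run d s T Q)
    (hU : T + 1 ≤ U) : Run (.ite b c d) s U Q := by
  by_cases hb : b.Holds s
  · obtain ⟨s', t, he, ht, hs⟩ := h hb
    exact ⟨s', t + 1, .ite_true hb he, by omega, hs⟩
  · obtain ⟨s', t, he, ht, hs⟩ := h' hb
    exact ⟨s', t + 1, .ite_false hb he, by omega, hs⟩

/-- The expression reading the scalar stored at entry `(0, 0)` of the array `a`. -/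
def cell (a : ℕ) : Expr := .load a (.const 0) (.const 0)

/-- The expression reading entry `(0, e)` of the array `a`. -/
def entry (a : ℕ) (e : Expr) : Expr := .load a (.const 0) e

/-- The test `e ≠ 0`. -/
def Test.pos (e : Expr) : Test := .natLe (.const 1) e

/-- The test `e = f`. -/
def Test.eq (e f : Expr) : Test := .and (.natLe e f) (.natLe f e)

@[simp] theorem eval_cell (s : Memory) (a : ℕ) : (cell a).eval s = s.nat a 0 0 := rfl

@[simp] theorem eval_entry (s : Memory) (a : ℕ) (e : Expr) :
    (entry a e).eval s = s.nat a 0 (e.eval s) := rfl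

@[simp] theorem holds_pos (s : Memory) (e : Expr) : (Test.pos e).Holds s ↔ e.eval s ≠ 0 :=
  Nat.one_le_iff_ne_zero

@[simp] theorem holds_eq (s : Memory) (e f : Expr) :
    (Test.eq e f).Holds s ↔ e.eval s = f.eval s := le_antisymm_iff.symm

@[simp] theorem setNat_real (s : Memory) (a i j x : ℕ) : (s.setNat a i j x).real = s.real := rfl

@[simp] theorem setReal_nat (s : Memory) (a i j : ℕ) (x : ℝ) :
    (s.setReal a i j x).nat = s.nat := rfl

theorem setNat_of_ne (s : Memory) {a a' : ℕ} (h : a' ≠ a) (i j x : ℕ) :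
    (s.setNat a i j x).nat a' = s.nat a' := by
  funext i' j'
  simp [Memory.setNat, h]

theorem setNat_self (s : Memory) (a i j x i' j' : ℕ) :
    (s.setNat a i j x).nat a i' j' = if i' = i ∧ j' = j then x else s.nat a i' j' := by
  simp [Memory.setNat]

theorem setReal_self (s : Memory) (a i j : ℕ) (x : ℝ) (i' j' : ℕ) :
    (s.setReal a i j x).real a i' j' = if i' = i ∧ j' = j then x else s.real a i' j' := by
  simp [Memory.setReal]

/-- Execute `c` for the values `0, …, N - 1` of the scalar `k`. -/
def forLoop (k : ℕ) (N : Expr) (c : Program) : Program :=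
  .seq (.assign k (.const 0) (.const 0) (.const 0))
    (.loop (.natLe (.add (cell k) (.const 1)) N)
      (.seq c (.assign k (.const 0) (.const 0) (.add (cell k) (.const 1)))))

theorem Run.forLoop {k L : ℕ} {N : Expr} {Inv : ℕ → Memory → Prop}
    (hN : ∀ x s, Inv x s → N.eval s = L)
    (hk : ∀ x s y, Inv x s → Inv x (s.setNat k 0 0 y)) (h0 : Inv 0 s)
    (hc : ∀ x < L, ∀ s, Inv x s → s.nat k 0 0 = x →
      Run c s T fun s' => Inv (x + 1) s' ∧ s'.nat k 0 0 = x) (hU : L * (T + 2) + 2 ≤ U) :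
    Run (forLoop k N c) s U (Inv L) := by
  have key : ∀ r x s, x + r = L → Inv x s → s.nat k 0 0 = x →
      Run (.loop (.natLe (.add (cell k) (.const 1)) N)
        (.seq c (.assign k (.const 0) (.const 0) (.add (cell k) (.const 1)))))
        s (r * (T + 2) + 1) (Inv L) := by
    intro r
    induction r with
    | zero =>
      intro x s hx hI hs
      refine ⟨s, 1, .loop_false ?_, by simp, ?_⟩
      · simp only [Test.Holds, Expr.eval, eval_cell, hN x s hI, hs]; omega
      · rwa [← hx, add_zero]
    | succ r ih =>
      intro x s hx hI hs
      obtain ⟨s₁, t₁, he₁, ht₁, hI₁, hs₁⟩ := hc x (by omega) s hI hs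
      obtain ⟨s₂, t₂, he₂, ht₂, hI₂⟩ := ih (x + 1) (s₁.setNat k 0 0 (x + 1)) (by omega)
        (hk _ _ _ hI₁) (by simp [setNat_self])
      refine ⟨s₂, (t₁ + 1) + t₂ + 1, .loop_true ?_ (.seq he₁ ?_) he₂, ?_, hI₂⟩
      · simp only [Test.Holds, Expr.eval, eval_cell, hN x s hI, hs]; omega
      · have := Exec.assign s₁ k (.const 0) (.const 0) (.add (cell k) (.const 1))
        simpa [Expr.eval, hs₁] using this
      · rw [Nat.succ_mul]; omega
  refine Run.seq (Run.assign (Q := fun s' => Inv 0 s' ∧ s'.nat k 0 0 = 0) ?_)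
    (fun s' hs' => key L 0 s' (zero_add L) hs'.1 hs'.2) (by omega)
  exact ⟨hk _ _ _ h0, by simp [setNat_self, Expr.eval]⟩

/-- The arrays `10, …, l - 1` of natural numbers, used as scratch space, are the only part of the
memory in which `s'` may differ from `s`. -/
def Keeps (l : ℕ) (s s' : Memory) : Prop :=
  (∀ a, a < 10 ∨ l ≤ a → s'.nat a = s.nat a) ∧ s'.real = s.real

theorem Keeps.refl (l : ℕ) (s : Memory) : Keeps l s s := ⟨fun _ _ => rfl, rfl⟩

theorem Keeps.trans {l : ℕ} {s₁ s₂ s₃ : Memory} (h : Keeps l s₁ s₂) (h' : Keeps l s₂ s₃) :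
    Keeps l s₁ s₃ :=
  ⟨fun a ha => (h'.1 a ha).trans (h.1 a ha), h'.2.trans h.2⟩

theorem Keeps.mono {l l' : ℕ} (h : Keeps l s s') (hl : l ≤ l') : Keeps l' s s' :=
  ⟨fun a ha => h.1 a (by omega), h.2⟩

theorem Keeps.setNat {l : ℕ} (s : Memory) {a : ℕ} (ha : 10 ≤ a) (hl : a < l) (i j x : ℕ) :
    Keeps l s (s.setNat a i j x) :=
  ⟨fun a' ha' => setNat_of_ne _ (by omega) _ _ _, rfl⟩

/-- Started in a memory satisfying `I`, the program `c` takes at most `T` steps, changes only the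
scratch arrays below `l`, and makes the truth value of the test `b` that of the proposition `P`. -/
def Decides (c : Program) (b : Test) (l : ℕ) (I : Memory → Prop) (P : Prop) (T : ℕ) : Prop :=
  ∀ s, I s → Run c s T fun s' => Keeps l s s' ∧ (b.Holds s' ↔ P)

theorem Decides.of_test {b : Test} {l : ℕ} {I : Memory → Prop} {P : Prop}
    (h : ∀ s, I s → (b.Holds s ↔ P)) : Decides .skip b l I P 1 :=
  fun s hs => Run.skip ⟨Keeps.refl l s, h s hs⟩

/-- A test can be combined with others, reading parts of the memory that are not changed. -/
theorem Decides.combine {b b' : Test} {l : ℕ} {I : Memory → Prop} {P P' : Prop}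
    (hd : Decides c b l I P T) (hI : ∀ s s', Keeps l s s' → I s → I s')
    (h : ∀ s, I s → (b.Holds s ↔ P) → (b'.Holds s ↔ P')) : Decides c b' l I P' T :=
  fun s hs => (hd s hs).mono (fun s' hs' => ⟨hs'.1, h s' (hI s s' hs'.1 hs) hs'.2⟩) le_rfl

/-- A program storing in the scalar `l + 1` whether all values of the scalar `l` below `N` pass the
test `b`, which is prepared by `c`. -/
def allProgram (l : ℕ) (N : Expr) (c : Program) (b : Test) : Program :=
  .seq (.assign (l + 1) (.const 0) (.const 0) (.const 1))
    (forLoop l N (.seq c (.ite b .skip (.assign (l + 1) (.const 0) (.const 0) (.const 0)))))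

theorem Decides.all {b : Test} {l L : ℕ} {N : Expr} {I : Memory → Prop} {P : Fin L → Prop}
    (hl : 10 ≤ l) (hI : ∀ s s', Keeps (l + 2) s s' → I s → I s') (hN : ∀ s, I s → N.eval s = L)
    (h : ∀ x : Fin L, Decides c b l (fun s => I s ∧ s.nat l 0 0 = x) (P x) T) :
    Decides (allProgram l N c b) (.pos (cell (l + 1))) (l + 2) I (∀ x, P x) (L * (T + 4) + 3) := by
  classical
  intro s hs
  let Inv : ℕ → Memory → Prop := fun x s' => Keeps (l + 2) s s' ∧
    s'.nat (l + 1) 0 0 = if ∀ y : Fin L, (y : ℕ) < x → P y then 1 else 0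
  refine (Run.seq (Run.assign (Q := Inv 0) ?_) (fun s' hs' =>
    (Run.forLoop (Inv := Inv) (T := T + 2) (L := L) ?_ ?_ hs' ?_ le_rfl))
    (le_of_eq (by ring))).mono ?_ le_rfl
  · exact ⟨Keeps.setNat s (by omega) (by omega) _ _ _, by simp [setNat_self, Expr.eval]⟩
  · exact fun x s' hs' => hN s' (hI s s' hs'.1 hs)
  · refine fun x s' y hs' => ⟨hs'.1.trans (Keeps.setNat s' hl (by omega) _ _ _), ?_⟩
    rw [setNat_of_ne _ (by omega)]
    exact hs'.2
  · intro x hx s₁ hs₁ hk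
    refine Run.seq (h ⟨x, hx⟩ s₁ ⟨hI s s₁ hs₁.1 hs, hk⟩) (fun s₂ hs₂ => Run.ite ?_ ?_ le_rfl) le_rfl
    · intro hb
      refine Run.skip ⟨⟨hs₁.1.trans (hs₂.1.mono (by omega)), ?_⟩, ?_⟩
      · rw [hs₂.1.1 (l + 1) (by omega), hs₁.2]
        refine if_congr ⟨fun hy y hyx => ?_, fun hy y hyx => hy y (by omega)⟩ rfl rfl
        rcases Nat.lt_succ_iff_lt_or_eq.1 hyx with hlt | heq
        · exact hy y hlt
        · exact (Fin.ext heq : y = ⟨x, hx⟩) ▸ hs₂.2.1 hb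
      · rw [hs₂.1.1 l (by omega), hk]
    · intro hb
      refine Run.assign ⟨⟨hs₁.1.trans ((hs₂.1.mono (by omega)).trans
        (Keeps.setNat _ (by omega) (by omega) _ _ _)), ?_⟩, ?_⟩
      · rw [if_neg fun hall => hb (hs₂.2.2 (hall ⟨x, hx⟩ (Nat.lt_succ_self x)))]
        simp [setNat_self, Expr.eval]
      · rw [setNat_of_ne _ (by omega), hs₂.1.1 l (by omega), hk]
  · rintro s' ⟨hk, hf⟩
    refine ⟨hk, ?_⟩
    rw [holds_pos, eval_cell, hf]
    simp

end Logic

/-! ### The program -/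

section Program

/-! Of the arrays of natural numbers, `3` to `6` hold the results that last; from `10` on, an array
is used only as a scalar, at its entry `(0, 0)`. The scalars `10`, `12`, `14`, `16` and `18` count
loops, `11`, `13` and `15` are the outcomes of `allProgram`, and `17` is the current player. -/

/-- The number of players. -/
def playersE : Expr := .load 0 (.const 0) (.const 0)

/-- The number of samples. -/
def samplesE : Expr := .load 0 (.const 0) (.const 1)

/-- Player `x` belongs to the sample `j`. -/
def memT (j x : Expr) : Test := .pos (.load 1 j x)

/-- Array `3` marks the samples without negative values. -/
def markProgram : Program :=
  forLoop 12 samplesE (.seq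
    (allProgram 10 playersE .skip (.not (.and (memT (cell 12) (cell 10))
      (.not (.realLe ⟨3, .const 0, .const 0⟩ ⟨1, cell 12, cell 10⟩)))))
    (.ite (.pos (cell 11)) (.assign 3 (.const 0) (cell 12) (.const 1)) .skip))

/-- The test that prepares `leafT`: the scalar `15` tells whether no player `p` is the neighbour of
the leaf stored in the scalar `16`. -/
def leafProgram : Program :=
  allProgram 14 playersE
    (allProgram 12 samplesE
      (allProgram 10 playersE .skip
        (.not (.and (memT (cell 12) (cell 10))
          (.and (.not (.pos (entry 4 (cell 10)))) (.not (.eq (cell 10) (cell 16)))))))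
      (.not (.and (.and (.pos (entry 3 (cell 12))) (memT (cell 12) (cell 16)))
        (.and (.not (.pos (cell 11)))
          (.not (.and (memT (cell 12) (cell 14)) (.not (.eq (cell 14) (cell 16)))))))))
    (.not (.and (.not (.pos (entry 4 (cell 14)))) (.pos (cell 13))))

/-- The player stored in the scalar `16` is a leaf of the remaining players. -/
def leafT : Test := .and (.not (.pos (entry 4 (cell 16)))) (.not (.pos (cell 15)))

/-- Store a leaf in the scalar `17`. -/
def findProgram : Program :=
  forLoop 16 playersE (.seq leafProgram
    (.ite leafT (.assign 17 (.const 0) (.const 0) (cell 16)) .skip))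

/-- Store in the arrays `6` and (of real numbers) `2` a best coalition, as the number of a sample
increased by `1`, and the guarantee level of the player stored in the scalar `17`. -/
def bestProgram : Program :=
  forLoop 12 samplesE (.seq
    (allProgram 10 playersE .skip (.not (.and (memT (cell 12) (cell 10)) (.not (.and
      (.not (.and (.not (.eq (cell 10) (cell 17))) (.not (.pos (entry 4 (cell 10))))))
      (.realLe ⟨2, .const 0, cell 10⟩ ⟨1, cell 12, cell 10⟩))))))
    (.ite (.and (memT (cell 12) (cell 17)) (.pos (cell 11)))
      (.seq (.assign 6 (.const 0) (cell 17) (.add (cell 12) (.const 1)))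
        (.copy ⟨2, .const 0, cell 17⟩ ⟨1, cell 12, cell 17⟩))
      .skip))

/-- Eliminate all players; array `4` holds the ranks, and array `5` the player of rank `k + 1`
at `(0, k)`. -/
def eliminateProgram : Program :=
  forLoop 18 playersE (.seq findProgram (.seq bestProgram (.seq
    (.assign 5 (.const 0) (.sub (.sub playersE (cell 18)) (.const 1)) (cell 17))
    (.assign 4 (.const 0) (cell 17) (.sub playersE (cell 18))))))

/-- Give every player in the coalition chosen for the player in the scalar `17` its label. -/
def labelProgram : Program :=
  forLoop 10 playersE (.ite
    (.not (.and (.not (.eq (cell 10) (cell 17))) (.not (.and (.pos (entry 6 (cell 17)))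
      (memT (.sub (entry 6 (cell 17)) (.const 1)) (cell 10))))))
    (.assign 2 (.const 0) (cell 10) (.add (cell 17) (.const 1))) .skip)

/-- Label the players in the order of increasing rank. -/
def assignProgram : Program :=
  forLoop 18 playersE (.seq
    (.assign 17 (.const 0) (.const 0) (entry 5 (cell 18)))
    (.ite (.pos (entry 2 (cell 17))) .skip labelProgram))

/-- The PAC stabilizing algorithm. -/
def stabilizer : Program := .seq markProgram (.seq eliminateProgram assignProgram)

end Program

/-! ### Correctness of the program -/

section Correctness

variable {n m : ℕ} {v : HedonicGame n} {ω : Fin m → Finset (Fin n)}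

/-- The number `b` encodes the coalition `B` as a choice of player `i`: it is `0` for `{i}`, and
`j + 1` for the sample `j`. -/
def Encodes (ω : Fin m → Finset (Fin n)) (i : Fin n) (b : ℕ) (B : Finset (Fin n)) : Prop :=
  (b = 0 ∧ B = {i}) ∨ ∃ j : Fin m, b = j + 1 ∧ B = ω j

/-- The memory holds the input, the marks of the first `q` samples, and the given ranks, order,
labels, coalitions and guarantee levels. -/
structure Stores (v : HedonicGame n) (ω : Fin m → Finset (Fin n)) (q : ℕ)
    (rank order label : Fin n → ℕ) (B : Fin n → Finset (Fin n)) (g : Fin n → ℝ)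
    (s : Memory) : Prop where
  players : s.nat 0 0 0 = n
  samples : s.nat 0 0 1 = m
  member : ∀ (j : Fin m) (x : Fin n), s.nat 1 j x ≠ 0 ↔ x ∈ ω j
  value : ∀ (j : Fin m), ∀ x ∈ ω j, s.real 1 j x = v x (ω j)
  zero : s.real 3 0 0 = 0
  mark : ∀ j : Fin m, s.nat 3 0 j ≠ 0 ↔ (j : ℕ) < q ∧ ∀ z ∈ ω j, 0 ≤ v z (ω j)
  rank : ∀ i : Fin n, s.nat 4 0 i = rank i
  order : ∀ i : Fin n, s.nat 5 0 i = order i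
  label : ∀ i : Fin n, s.nat 2 0 i = label i
  best : ∀ i : Fin n, Encodes ω i (s.nat 6 0 i) (B i)
  level : ∀ i : Fin n, s.real 2 0 i = g i

variable {q t l : ℕ} {rank order label : Fin n → ℕ} {B : Fin n → Finset (Fin n)} {g : Fin n → ℝ}
  {s s' : Memory}

theorem Stores.of_eq (h : Stores v ω q rank order label B g s)
    (hn : ∀ a < 10, s'.nat a = s.nat a) (hr : s'.real = s.real) :
    Stores v ω q rank order label B g s' := by
  constructor
  · rw [hn 0 (by omega)]; exact h.players
  · rw [hn 0 (by omega)]; exact h.samples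
  · rw [hn 1 (by omega)]; exact h.member
  · rw [hr]; exact h.value
  · rw [hr]; exact h.zero
  · rw [hn 3 (by omega)]; exact h.mark
  · rw [hn 4 (by omega)]; exact h.rank
  · rw [hn 5 (by omega)]; exact h.order
  · rw [hn 2 (by omega)]; exact h.label
  · rw [hn 6 (by omega)]; exact h.best
  · rw [hr]; exact h.level

theorem Stores.keeps (h : Stores v ω q rank order label B g s) (hk : Keeps l s s') :
    Stores v ω q rank order label B g s' :=
  h.of_eq (fun a ha => hk.1 a (Or.inl ha)) hk.2

theorem Stores.setScalar (h : Stores v ω q rank order label B g s) {a : ℕ} (ha : 10 ≤ a)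
    (i j x : ℕ) : Stores v ω q rank order label B g (s.setNat a i j x) :=
  h.of_eq (fun _ hb => setNat_of_ne _ (by omega) _ _ _) rfl

theorem Stores.setMark (h : Stores v ω q rank order label B g s) {j : Fin m} (hj : (j : ℕ) = q)
    (hS : ∀ z ∈ ω j, 0 ≤ v z (ω j)) :
    Stores v ω (q + 1) rank order label B g (s.setNat 3 0 j 1) := by
  refine ⟨h.players, h.samples, h.member, h.value, h.zero, fun k => ?_, h.rank, h.order, h.label,
    h.best, h.level⟩
  rw [setNat_self]
  by_cases hk : k = j
  · subst hk
    simpa [hj] using hS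
  · have hk' : (k : ℕ) ≠ j := fun e => hk (Fin.ext e)
    rw [if_neg fun e => hk' e.2, h.mark k]
    have : (k : ℕ) < q + 1 ↔ (k : ℕ) < q := by omega
    rw [this]

theorem Stores.skipMark (h : Stores v ω q rank order label B g s) {j : Fin m} (hj : (j : ℕ) = q)
    (hS : ¬ ∀ z ∈ ω j, 0 ≤ v z (ω j)) : Stores v ω (q + 1) rank order label B g s := by
  refine ⟨h.players, h.samples, h.member, h.value, h.zero, fun k => ?_, h.rank, h.order, h.label,
    h.best, h.level⟩
  rw [h.mark k]
  by_cases hk : k = j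
  · subst hk
    simp [hS]
  · have hk' : (k : ℕ) ≠ j := fun e => hk (Fin.ext e)
    have : (k : ℕ) < q + 1 ↔ (k : ℕ) < q := by omega
    rw [this]

/-- Writing into a row of an array, as the update of a function on the players. -/
theorem update_apply_val {α : Type*} (f : Fin n → α) (i k : Fin n) (x : α) :
    (if 0 = 0 ∧ (k : ℕ) = i then x else f k) = Function.update f i x k := by
  by_cases hk : k = i
  · subst hk; simp
  · have hk' : (k : ℕ) ≠ i := fun e => hk (Fin.ext e)
    rw [Function.update_of_ne hk, if_neg fun e => hk' e.2]

theorem Stores.setRank (h : Stores v ω q rank order label B g s) (i : Fin n) (x : ℕ) :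
    Stores v ω q (Function.update rank i x) order label B g (s.setNat 4 0 i x) :=
  ⟨h.players, h.samples, h.member, h.value, h.zero, h.mark, fun k => by
    rw [setNat_self, h.rank k, update_apply_val], h.order, h.label, h.best, h.level⟩

theorem Stores.setOrder (h : Stores v ω q rank order label B g s) (i : Fin n) (x : ℕ) :
    Stores v ω q rank (Function.update order i x) label B g (s.setNat 5 0 i x) :=
  ⟨h.players, h.samples, h.member, h.value, h.zero, h.mark, h.rank, fun k => by
    rw [setNat_self, h.order k, update_apply_val], h.label, h.best, h.level⟩

theorem Stores.setLabel (h : Stores v ω q rank order label B g s) (i : Fin n) (x : ℕ) :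
    Stores v ω q rank order (Function.update label i x) B g (s.setNat 2 0 i x) :=
  ⟨h.players, h.samples, h.member, h.value, h.zero, h.mark, h.rank, h.order, fun k => by
    rw [setNat_self, h.label k, update_apply_val], h.best, h.level⟩

theorem Stores.setBest (h : Stores v ω q rank order label B g s) (i : Fin n) (j : Fin m) :
    Stores v ω q rank order label (Function.update B i (ω j)) g (s.setNat 6 0 i (j + 1)) := by
  refine ⟨h.players, h.samples, h.member, h.value, h.zero, h.mark, h.rank, h.order, h.label,
    fun k => ?_, h.level⟩
  rw [setNat_self]
  by_cases hk : k = i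
  · subst hk
    simp only [and_self, if_true, Function.update_self]
    exact Or.inr ⟨j, rfl, rfl⟩
  · have hk' : (k : ℕ) ≠ i := fun e => hk (Fin.ext e)
    rw [Function.update_of_ne hk, if_neg fun e => hk' e.2]
    exact h.best k

theorem Stores.setLevel (h : Stores v ω q rank order label B g s) (i : Fin n) (x : ℝ) :
    Stores v ω q rank order label B (Function.update g i x) (s.setReal 2 0 i x) :=
  ⟨h.players, h.samples, h.member, h.value, h.zero, h.mark, h.rank, h.order, h.label, h.best,
    fun k => by rw [setReal_self, h.level k, update_apply_val]⟩

theorem Stores.start (v : HedonicGame n) (ε δ : ℝ) (ω : Fin m → Finset (Fin n)) :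
    Stores v ω 0 (fun _ => 0) (fun _ => 0) (fun _ => 0) (fun i => {i}) (fun _ => 0)
      (inputMemory v ε δ ω) := by
  constructor <;> intros <;> simp_all [inputMemory, Encodes]

/-- Time of a test for all players. -/
def scanTime (n : ℕ) : ℕ := n * (1 + 4) + 3

/-- Time of marking the samples without negative values. -/
def markTime (n m : ℕ) : ℕ := m * (scanTime n + 4) + 2

/-- Time of the leaf test. -/
def leafTime (n m : ℕ) : ℕ := n * (m * (scanTime n + 4) + 3 + 4) + 3

/-- Time of finding a leaf. -/
def findTime (n m : ℕ) : ℕ := n * (leafTime n m + 4) + 2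

/-- Time of finding a best coalition. -/
def bestTime (n m : ℕ) : ℕ := m * (scanTime n + 5) + 2

/-- Time of the elimination of all players. -/
def eliminateTime (n m : ℕ) : ℕ := n * (findTime n m + bestTime n m + 4) + 2

/-- Time of assigning the coalitions. -/
def assignTime (n : ℕ) : ℕ := n * (n * 4 + 7) + 2

theorem markProgram_run (h : Stores v ω 0 rank order label B g s) :
    Run markProgram s (markTime n m)
      (Stores v ω m rank order label B g) := by
  refine Run.forLoop (Inv := fun q => Stores v ω q rank order label B g) (T := scanTime n + 2)
    (fun q s hs => hs.samples) (fun q s y hs => hs.setScalar (by omega) _ _ _) h ?_ le_rfl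
  intro q hq s hs hj
  let j : Fin m := ⟨q, hq⟩
  have hall : Decides (allProgram 10 playersE .skip (.not (.and (memT (cell 12) (cell 10))
      (.not (.realLe ⟨3, .const 0, .const 0⟩ ⟨1, cell 12, cell 10⟩))))) (.pos (cell 11)) 12
      (fun s => Stores v ω q rank order label B g s ∧ s.nat 12 0 0 = q)
      (∀ z, ¬ (z ∈ ω j ∧ ¬ 0 ≤ v z (ω j))) (scanTime n) := by
    refine Decides.all (N := playersE) le_rfl ?_ (fun s hs => hs.1.players)
      fun z => Decides.of_test ?_
    · exact fun s s' hk hs => ⟨hs.1.keeps hk, by rw [hk.1 12 (by omega)]; exact hs.2⟩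
    · rintro s ⟨⟨hs, hq⟩, hz⟩
      have hm := hs.member j z
      have hv := hs.value j z
      simp only [Test.Holds, memT, holds_pos, Expr.eval, eval_cell, RealCell.eval, hq, hz,
        hs.zero] at hm hv ⊢
      rw [hm]
      refine not_congr (and_congr_right fun hzj => ?_)
      rw [hv hzj]
  refine Run.seq (hall s ⟨hs, hj⟩) (U := 2) (fun s' hs' => ?_) le_rfl
  have hst := hs.keeps hs'.1
  have h12 : s'.nat 12 0 0 = q := by rw [hs'.1.1 12 (by omega), hj]
  refine Run.ite (fun hb => Run.assign ⟨?_, ?_⟩) (fun hb => Run.skip ⟨?_, h12⟩) le_rfl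
  · have := hst.setMark (j := j) rfl fun z hz => not_not.1 fun hn => hs'.2.1 hb z ⟨hz, hn⟩
    simpa [Expr.eval, h12] using this
  · rw [setNat_of_ne _ (by omega), h12]
  · exact hst.skipMark (j := j) rfl fun hall => hb (hs'.2.2 fun z hz => hz.2 (hall z hz.1))

/-- The family that the leaf test refers to. -/
theorem mem_nonnegative_range {S : Finset (Fin n)} :
    S ∈ nonnegative v (Set.range ω) ↔ ∃ j, S = ω j ∧ ∀ z ∈ ω j, 0 ≤ v z (ω j) := by
  constructor
  · rintro ⟨⟨j, rfl⟩, h⟩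
    exact ⟨j, rfl, h⟩
  · rintro ⟨j, rfl, h⟩
    exact ⟨⟨j, rfl⟩, h⟩

/-- The arrays `10` to `15` are scratch space for the three nested loops of the leaf test. -/
theorem leafProgram_decides (i : Fin n) :
    Decides leafProgram leafT 16
      (fun s => Stores v ω m rank order label B g s ∧ s.nat 16 0 0 = i)
      (∃ p, IsLeaf (nonnegative v (Set.range ω)) ({i | rank i = 0} : Finset (Fin n)) i p)
      (leafTime n m) := by
  have hz : ∀ (p : Fin n) (j : Fin m), Decides (allProgram 10 playersE .skip
      (.not (.and (memT (cell 12) (cell 10))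
        (.and (.not (.pos (entry 4 (cell 10)))) (.not (.eq (cell 10) (cell 16)))))))
      (.pos (cell 11)) 12
      (fun s => ((Stores v ω m rank order label B g s ∧ s.nat 16 0 0 = i) ∧ s.nat 14 0 0 = p) ∧
        s.nat 12 0 0 = j)
      (∀ z, ¬ (z ∈ ω j ∧ rank z = 0 ∧ z ≠ i)) (scanTime n) := by
    intro p j
    refine Decides.all (N := playersE) le_rfl ?_ (fun s hs => hs.1.1.1.players)
      fun z => Decides.of_test ?_
    · rintro s s' hk ⟨⟨⟨h1, h2⟩, h3⟩, h4⟩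
      refine ⟨⟨⟨h1.keeps hk, ?_⟩, ?_⟩, ?_⟩
      · rw [hk.1 16 (by omega)]; exact h2
      · rw [hk.1 14 (by omega)]; exact h3
      · rw [hk.1 12 (by omega)]; exact h4
    · rintro s ⟨⟨⟨⟨hs, h2⟩, h3⟩, h4⟩, h5⟩
      have hm := hs.member j z
      have hr := hs.rank z
      simp only [Test.Holds, memT, holds_pos, holds_eq, Expr.eval, eval_cell, eval_entry, h2, h4,
        h5, hr, hm, not_not, Fin.val_inj, ne_eq]
  have hj : ∀ p : Fin n, Decides (allProgram 12 samplesE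
      (allProgram 10 playersE .skip
        (.not (.and (memT (cell 12) (cell 10))
          (.and (.not (.pos (entry 4 (cell 10)))) (.not (.eq (cell 10) (cell 16)))))))
      (.not (.and (.and (.pos (entry 3 (cell 12))) (memT (cell 12) (cell 16)))
        (.and (.not (.pos (cell 11)))
          (.not (.and (memT (cell 12) (cell 14)) (.not (.eq (cell 14) (cell 16)))))))))
      (.pos (cell 13)) 14
      (fun s => (Stores v ω m rank order label B g s ∧ s.nat 16 0 0 = i) ∧ s.nat 14 0 0 = p)
      (∀ j : Fin m, ¬ (((∀ z ∈ ω j, 0 ≤ v z (ω j)) ∧ i ∈ ω j) ∧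
        ¬ (∀ z, ¬ (z ∈ ω j ∧ rank z = 0 ∧ z ≠ i)) ∧ ¬ (p ∈ ω j ∧ p ≠ i)))
      (m * (scanTime n + 4) + 3) := by
    intro p
    refine Decides.all (N := samplesE) (l := 12) (by omega) ?_ (fun s hs => hs.1.1.samples)
      fun j => (hz p j).combine
        (b' := .not (.and (.and (.pos (entry 3 (cell 12))) (memT (cell 12) (cell 16)))
        (.and (.not (.pos (cell 11)))
          (.not (.and (memT (cell 12) (cell 14)) (.not (.eq (cell 14) (cell 16)))))))) ?_ ?_
    · rintro s s' hk ⟨⟨h1, h2⟩, h3⟩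
      refine ⟨⟨h1.keeps hk, ?_⟩, ?_⟩
      · rw [hk.1 16 (by omega)]; exact h2
      · rw [hk.1 14 (by omega)]; exact h3
    · rintro s s' hk ⟨⟨⟨h1, h2⟩, h3⟩, h4⟩
      refine ⟨⟨⟨h1.keeps hk, ?_⟩, ?_⟩, ?_⟩
      · rw [hk.1 16 (by omega)]; exact h2
      · rw [hk.1 14 (by omega)]; exact h3
      · rw [hk.1 12 (by omega)]; exact h4
    · rintro s ⟨⟨⟨hs, h2⟩, h3⟩, h4⟩ hb
      have hm := hs.member j i
      have hp := hs.member j p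
      have hk := hs.mark j
      simp only [j.isLt, true_and] at hk
      simp only [Test.Holds, memT, holds_pos, holds_eq, Expr.eval, eval_cell, eval_entry, h2, h3,
        h4] at hb ⊢
      rw [hb, hm, hp, hk, Fin.val_inj]
  have hp : Decides leafProgram (.pos (cell 15)) 16
      (fun s => Stores v ω m rank order label B g s ∧ s.nat 16 0 0 = i)
      (∀ p : Fin n, ¬ (rank p = 0 ∧ ∀ j : Fin m, ¬ (((∀ z ∈ ω j, 0 ≤ v z (ω j)) ∧ i ∈ ω j) ∧
        ¬ (∀ z, ¬ (z ∈ ω j ∧ rank z = 0 ∧ z ≠ i)) ∧ ¬ (p ∈ ω j ∧ p ≠ i))))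
      (leafTime n m) := by
    refine Decides.all (l := 14) (N := playersE) (by omega) ?_ (fun s hs => hs.1.players)
      fun p => (hj p).combine ?_ ?_
    · rintro s s' hk ⟨h1, h2⟩
      exact ⟨h1.keeps hk, by rw [hk.1 16 (by omega)]; exact h2⟩
    · rintro s s' hk ⟨⟨h1, h2⟩, h3⟩
      refine ⟨⟨h1.keeps hk, ?_⟩, ?_⟩
      · rw [hk.1 16 (by omega)]; exact h2
      · rw [hk.1 14 (by omega)]; exact h3
    · rintro s ⟨⟨hs, h2⟩, h3⟩ hb
      have hr := hs.rank p
      simp only [Test.Holds, holds_pos, eval_cell, eval_entry, h3] at hb ⊢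
      rw [hb, hr, not_not]
  refine hp.combine ?_ ?_
  · rintro s s' hk ⟨h1, h2⟩
    exact ⟨h1.keeps hk, by rw [hk.1 16 (by omega)]; exact h2⟩
  · rintro s ⟨hs, h2⟩ hb
    have hr := hs.rank i
    simp only [Test.Holds, leafT, holds_pos, eval_cell, eval_entry, h2] at hb ⊢
    rw [hb, hr, not_not]
    constructor
    · rintro ⟨hi, hp⟩
      push Not at hp
      obtain ⟨p, hp0, hp⟩ := hp
      refine ⟨p, by simpa using hi, by simpa using hp0, ?_⟩
      rintro S hS hiS z hzS hzR hzi
      obtain ⟨j, rfl, hj⟩ := mem_nonnegative_range.1 hS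
      exact hp j ⟨hj, hiS⟩ ⟨z, hzS, by simpa using hzR, hzi⟩
    · rintro ⟨p, hi, hp, hl⟩
      refine ⟨by simpa using hi, fun hall => hall p ⟨by simpa using hp, ?_⟩⟩
      rintro j ⟨⟨hj, hij⟩, hz, hpj⟩
      push Not at hz
      obtain ⟨z, hzj, hz0, hzi⟩ := hz
      exact hpj (hl _ (mem_nonnegative_range.2 ⟨j, rfl, hj⟩) hij z hzj (by simpa using hz0) hzi)

theorem findProgram_run (h : Stores v ω m rank order label B g s) (ht : s.nat 18 0 0 = t)
    (hl : ∃ i p, IsLeaf (nonnegative v (Set.range ω)) ({i | rank i = 0} : Finset (Fin n)) i p) :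
    Run findProgram s (findTime n m)
      fun s => Stores v ω m rank order label B g s ∧ s.nat 18 0 0 = t ∧ ∃ i p : Fin n,
        s.nat 17 0 0 = i ∧
          IsLeaf (nonnegative v (Set.range ω)) ({i | rank i = 0} : Finset (Fin n)) i p := by
  let L : Fin n → Prop := fun i =>
    ∃ p, IsLeaf (nonnegative v (Set.range ω)) ({i | rank i = 0} : Finset (Fin n)) i p
  let Inv : ℕ → Memory → Prop := fun x s => Stores v ω m rank order label B g s ∧
    s.nat 18 0 0 = t ∧ ((∃ i : Fin n, (i : ℕ) < x ∧ L i) → ∃ i : Fin n, s.nat 17 0 0 = i ∧ L i)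
  refine (Run.forLoop (Inv := Inv) (L := n) (N := playersE) (T := leafTime n m + 2)
    (fun x s hs => hs.1.players) ?_ ?_ ?_ le_rfl).mono ?_ le_rfl
  · refine fun x s y hs => ⟨hs.1.setScalar (by omega) _ _ _, ?_⟩
    rw [setNat_of_ne _ (by omega), setNat_of_ne _ (by omega)]
    exact hs.2
  · refine ⟨h, ht, ?_⟩
    rintro ⟨i, hi, -⟩
    omega
  · intro x hx s hs h16
    refine Run.seq (leafProgram_decides ⟨x, hx⟩ s ⟨hs.1, h16⟩) (U := 2) (fun s' hs' => ?_) le_rfl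
    have hst := hs.1.keeps hs'.1
    have h18 : s'.nat 18 0 0 = t := by rw [hs'.1.1 18 (by omega)]; exact hs.2.1
    have h16' : s'.nat 16 0 0 = x := by rw [hs'.1.1 16 (by omega), h16]
    refine Run.ite (fun hb => Run.assign ⟨⟨hst.setScalar (by omega) _ _ _, ?_, ?_⟩, ?_⟩)
      (fun hb => Run.skip ⟨⟨hst, h18, ?_⟩, h16'⟩) le_rfl
    · rw [setNat_of_ne _ (by omega), h18]
    · exact fun _ => ⟨⟨x, hx⟩, by simp [setNat_self, Expr.eval, h16'], hs'.2.1 hb⟩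
    · rw [setNat_of_ne _ (by omega), h16']
    · rintro ⟨i, hi, hLi⟩
      rw [hs'.1.1 17 (by omega)]
      refine hs.2.2 ⟨i, ?_, hLi⟩
      refine lt_of_le_of_ne (Nat.lt_succ_iff.1 hi) fun e => hb (hs'.2.2 ?_)
      exact (Fin.ext e : i = ⟨x, hx⟩) ▸ hLi
  · rintro s ⟨h1, h2, h3⟩
    obtain ⟨i, hi⟩ := hl
    obtain ⟨k, hk, p, hp⟩ := h3 ⟨i, i.isLt, hi⟩
    exact ⟨h1, h2, k, p, hk, hp⟩

/-- The samples inspected before the sample number `x`. -/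
def firstSamples (ω : Fin m → Finset (Fin n)) (x : ℕ) : Set (Finset (Fin n)) :=
  {S | ∃ j : Fin m, (j : ℕ) < x ∧ S = ω j}

theorem firstSamples_succ (j : Fin m) :
    firstSamples ω (j + 1) = insert (ω j) (firstSamples ω j) := by
  ext S
  constructor
  · rintro ⟨k, hk, rfl⟩
    rcases Nat.lt_succ_iff_lt_or_eq.1 hk with hlt | heq
    · exact Or.inr ⟨k, hlt, rfl⟩
    · exact Or.inl (by rw [Fin.ext heq])
  · rintro (rfl | ⟨k, hk, rfl⟩)
    · exact ⟨j, Nat.lt_succ_self _, rfl⟩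
    · exact ⟨k, by omega, rfl⟩

theorem firstSamples_self : firstSamples ω m = Set.range ω := by
  ext S
  constructor
  · rintro ⟨j, -, rfl⟩
    exact ⟨j, rfl⟩
  · rintro ⟨j, rfl⟩
    exact ⟨j, j.isLt, rfl⟩

/-- The level of `i` starts at `0`, the value of its singleton, and is raised while the samples are
inspected; a sample is compared with the best of those before it. -/
theorem bestProgram_run (h : Stores v ω m rank order label B g s) (ht : s.nat 18 0 0 = t)
    {i : Fin n} (h17 : s.nat 17 0 0 = i) (hB : B i = {i}) (hg : g i = 0) :
    Run bestProgram s (bestTime n m) fun s => ∃ B' g',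
      Stores v ω m rank order label (Function.update B i B') g' s ∧ s.nat 18 0 0 = t ∧
      s.nat 17 0 0 = i ∧ (∀ z, z ≠ i → g' z = g z) ∧
      IsBest v rank g' i (Set.range ω) B' := by
  let Inv : ℕ → Memory → Prop := fun x s => ∃ B' g',
    Stores v ω m rank order label (Function.update B i B') g' s ∧ s.nat 18 0 0 = t ∧
    s.nat 17 0 0 = i ∧ (∀ z, z ≠ i → g' z = g z) ∧ IsBest v rank g' i (firstSamples ω x) B'
  refine (Run.forLoop (Inv := Inv) (L := m) (N := samplesE) (T := scanTime n + 3) ?_ ?_ ?_ ?_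
    le_rfl).mono ?_ le_rfl
  · rintro x s ⟨B', g', hs, -⟩
    exact hs.samples
  · rintro x s y ⟨B', g', hs, h1, h2, h3⟩
    refine ⟨B', g', hs.setScalar (by omega) _ _ _, ?_, ?_, h3⟩
    · rw [setNat_of_ne _ (by omega), h1]
    · rw [setNat_of_ne _ (by omega), h2]
  · refine ⟨{i}, g, ?_, ht, h17, fun _ _ => rfl, mem_singleton_self i, hg.ge, Or.inl ⟨rfl, hg⟩,
      fun z hz hzi => absurd (mem_singleton.1 hz) hzi, ?_⟩
    · rwa [← hB, Function.update_eq_self]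
    · rintro S ⟨j, hj, -⟩
      omega
  · rintro x hx s ⟨B', g', hs, h18, h17, hg', hbest⟩ h12
    let j : Fin m := ⟨x, hx⟩
    have hall : Decides (allProgram 10 playersE .skip
        (.not (.and (memT (cell 12) (cell 10)) (.not (.and
          (.not (.and (.not (.eq (cell 10) (cell 17))) (.not (.pos (entry 4 (cell 10))))))
          (.realLe ⟨2, .const 0, cell 10⟩ ⟨1, cell 12, cell 10⟩))))))
        (.pos (cell 11)) 12
        (fun s => (Stores v ω m rank order label (Function.update B i B') g' s ∧
          s.nat 17 0 0 = i) ∧ s.nat 12 0 0 = x)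
        (∀ z, ¬ (z ∈ ω j ∧ ¬ (¬ (¬ z = i ∧ ¬ rank z ≠ 0) ∧ g' z ≤ v z (ω j))))
        (scanTime n) := by
      refine Decides.all (N := playersE) le_rfl ?_ (fun s hs => hs.1.1.players)
        fun z => Decides.of_test ?_
      · rintro s s' hk ⟨⟨h1, h2⟩, h3⟩
        refine ⟨⟨h1.keeps hk, ?_⟩, ?_⟩
        · rw [hk.1 17 (by omega)]; exact h2
        · rw [hk.1 12 (by omega)]; exact h3
      · rintro s ⟨⟨⟨hs, h2⟩, h3⟩, h4⟩
        have hm := hs.member j z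
        have hv := hs.value j z
        have hr := hs.rank z
        have hl := hs.level z
        simp only [Test.Holds, memT, holds_pos, holds_eq, Expr.eval, eval_cell, eval_entry,
          RealCell.eval, h2, h3, h4, hr, hl, Fin.val_inj] at hm hv ⊢
        rw [hm]
        refine not_congr (and_congr_right fun hzj => ?_)
        rw [hv hzj]
    refine Run.seq (hall s ⟨⟨hs, h17⟩, h12⟩) (U := 3) (fun s' hs' => ?_) le_rfl
    have hst := hs.keeps hs'.1
    have h18' : s'.nat 18 0 0 = t := by rw [hs'.1.1 18 (by omega), h18]
    have h17' : s'.nat 17 0 0 = i := by rw [hs'.1.1 17 (by omega), h17]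
    have h12' : s'.nat 12 0 0 = x := by rw [hs'.1.1 12 (by omega), h12]
    have hsucc : firstSamples ω (x + 1) = insert (ω j) (firstSamples ω x) := firstSamples_succ j
    have htest : (Test.and (memT (cell 12) (cell 17)) (.pos (cell 11))).Holds s' ↔
        i ∈ ω j ∧ ∀ z ∈ ω j, (z = i ∨ rank z ≠ 0) ∧ g' z ≤ v z (ω j) := by
      have hm := hst.member j i
      have h2 := hs'.2
      simp only [Test.Holds, memT, holds_pos, Expr.eval, eval_cell, h17', h12'] at hm h2 ⊢
      rw [hm, h2]
      refine and_congr_right fun _ => forall_congr' fun z => ?_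
      tauto
    refine Run.ite (T := 2) (fun hb => ?_) (fun hb => (Run.skip
      ⟨⟨B', g', hst, h18', h17', hg', ?_⟩, h12'⟩).mono (fun _ h => h) (by omega)) le_rfl
    · obtain ⟨hij, hz⟩ := htest.1 hb
      refine Run.seq (Run.assign (Q := fun s => Stores v ω m rank order label
        (Function.update B i (ω j)) g' s ∧ s.nat 18 0 0 = t ∧ s.nat 17 0 0 = i ∧
        s.nat 12 0 0 = x) ?_) (fun s₂ hs₂ => Run.copy ?_) le_rfl
      · have := hst.setBest i j
        rw [Function.update_idem] at this
        refine ⟨by simpa [Expr.eval, h17', h12'] using this, ?_, ?_, ?_⟩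
        · rw [setNat_of_ne _ (by omega), h18']
        · rw [setNat_of_ne _ (by omega), h17']
        · rw [setNat_of_ne _ (by omega), h12']
      · obtain ⟨hst₂, h18₂, h17₂, h12₂⟩ := hs₂
        refine ⟨⟨ω j, Function.update g' i (v i (ω j)), ?_, h18₂, h17₂, fun z hzi => ?_, ?_⟩, h12₂⟩
        · have hval : s₂.real 1 x i = v i (ω j) := hst₂.value j i hij
          simpa [Expr.eval, RealCell.eval, h17₂, h12₂, hval] using hst₂.setLevel i (v i (ω j))
        · rw [Function.update_of_ne hzi]; exact hg' z hzi
        · rw [hsucc]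
          exact hbest.insert_of_pass hij hz
    · rw [hsucc]
      exact hbest.insert_of_fail fun hc => hb (htest.2 hc)
  · rintro s ⟨B', g', h1, h2, h3, h4, h5⟩
    exact ⟨B', g', h1, h2, h3, h4, firstSamples_self (ω := ω) ▸ h5⟩

theorem eliminateProgram_run (h : Stores v ω m (fun _ => 0) order label (fun i => {i})
      (fun _ => 0) s) (hv : ∀ i, v i {i} = 0)
    (hE : Eliminable (nonnegative v (Set.range ω)) univ) :
    Run eliminateProgram s (eliminateTime n m)
      fun s => ∃ rank order B g, Stores v ω m rank order label B g s ∧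
        GuaranteeState v (Set.range ω) n rank order B g := by
  let Inv : ℕ → Memory → Prop := fun t s => ∃ rank order B g,
    Stores v ω m rank order label B g s ∧ GuaranteeState v (Set.range ω) t rank order B g
  refine Run.forLoop (Inv := Inv) (N := playersE) (T := findTime n m + bestTime n m + 2) ?_ ?_
    ⟨_, _, _, _, h, .start hv hE⟩ ?_ le_rfl
  · rintro x s ⟨_, _, _, _, hs, -⟩
    exact hs.players
  · rintro x s y ⟨_, _, _, _, hs, hg⟩
    exact ⟨_, _, _, _, hs.setScalar (by omega) _ _ _, hg⟩
  · rintro t ht s ⟨rank, order, B, g, hs, hG⟩ h18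
    refine Run.seq (findProgram_run hs h18 (hG.exists_leaf ht)) (U := bestTime n m + 2) ?_
      (by omega)
    rintro s₁ ⟨hs₁, h18₁, i, p, h17₁, hleaf⟩
    have hi : rank i = 0 := by simpa using hleaf.1
    refine Run.seq (bestProgram_run hs₁ h18₁ h17₁ (hG.fresh i hi).1 (hG.fresh i hi).2) (U := 2)
      ?_ le_rfl
    rintro s₂ ⟨B', g', hs₂, h18₂, h17₂, hg', hbest⟩
    have hn := hs₂.players
    refine Run.seq (Run.assign (Q := fun s => Stores v ω m rank
      (Function.update order ⟨n - t - 1, by omega⟩ i) label (Function.update B i B') g' s ∧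
      s.nat 18 0 0 = t ∧ s.nat 17 0 0 = i) ⟨?_, ?_, ?_⟩) (U := 1) ?_ le_rfl
    · have := hs₂.setOrder ⟨n - t - 1, by omega⟩ i
      simpa [Expr.eval, playersE, hn, h18₂, h17₂] using this
    · rw [setNat_of_ne _ (by omega), h18₂]
    · rw [setNat_of_ne _ (by omega), h17₂]
    · rintro s₃ ⟨hs₃, h18₃, h17₃⟩
      have hn₃ := hs₃.players
      refine Run.assign ⟨⟨_, _, _, _, ?_, hG.step ht hleaf hg' hbest (hv i)⟩, ?_⟩
      · have := hs₃.setRank i (n - t)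
        simpa [Expr.eval, playersE, hn₃, h18₃, h17₃] using this
      · rw [setNat_of_ne _ (by omega), h18₃]

theorem labelProgram_run (h : Stores v ω m rank order label B g s) (ht : s.nat 18 0 0 = t)
    {i : Fin n} (h17 : s.nat 17 0 0 = i) (hi : i ∈ B i) :
    Run labelProgram s (n * 4 + 2) fun s =>
      Stores v ω m rank order (fun x => if x ∈ B i then i + 1 else label x) B g s ∧
        s.nat 18 0 0 = t := by
  let Inv : ℕ → Memory → Prop := fun y s =>
    Stores v ω m rank order (fun x => if (x : ℕ) < y ∧ x ∈ B i then i + 1 else label x) B g s ∧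
      s.nat 18 0 0 = t ∧ s.nat 17 0 0 = i
  refine (Run.forLoop (Inv := Inv) (L := n) (N := playersE) (T := 2) (fun x s hs => hs.1.players)
    ?_ ?_ ?_ le_rfl).mono ?_ le_rfl
  · rintro x s y ⟨h1, h2, h3⟩
    refine ⟨h1.setScalar (by omega) _ _ _, ?_, ?_⟩
    · rw [setNat_of_ne _ (by omega), h2]
    · rw [setNat_of_ne _ (by omega), h3]
  · exact ⟨by simpa using h, ht, h17⟩
  · rintro x hx s ⟨hs, h18, h17⟩ h10
    let z : Fin n := ⟨x, hx⟩
    have htest : (Test.not (.and (.not (.eq (cell 10) (cell 17)))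
        (.not (.and (.pos (entry 6 (cell 17)))
          (memT (.sub (entry 6 (cell 17)) (.const 1)) (cell 10)))))).Holds s ↔ z ∈ B i := by
      have hz : x = (i : ℕ) ↔ z = i := ⟨fun e => Fin.ext e, fun e => congrArg Fin.val e⟩
      simp only [Test.Holds, memT, holds_pos, holds_eq, Expr.eval, eval_cell, eval_entry, h17, h10]
      rw [hz]
      rcases hs.best i with ⟨hb, hB⟩ | ⟨j, hb, hB⟩
      · rw [hb, hB, mem_singleton]
        tauto
      · have hm : s.nat 1 j x ≠ 0 ↔ z ∈ ω j := hs.member j z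
        rw [hB] at hi ⊢
        rw [hb, Nat.add_sub_cancel, hm]
        by_cases hzi : z = i
        · simp [hzi, hi]
        · simp [hzi]
    have hupd : ∀ y : Fin n, y ≠ z → ((y : ℕ) < x + 1 ↔ (y : ℕ) < x) := fun y hy => by
      have : (y : ℕ) ≠ x := fun e => hy (Fin.ext e)
      omega
    refine Run.ite (fun hb => Run.assign ⟨⟨?_, ?_, ?_⟩, ?_⟩)
      (fun hb => Run.skip ⟨⟨?_, h18, h17⟩, h10⟩) le_rfl
    · have := hs.setLabel z (i + 1)
      convert this using 1
      · funext y
        by_cases hy : y = z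
        · subst hy
          rw [Function.update_self, if_pos ⟨Nat.lt_succ_self x, htest.1 hb⟩]
        · simp only [Function.update_of_ne hy, hupd y hy]
      · simp [Expr.eval, h10, h17, z]
    · rw [setNat_of_ne _ (by omega), h18]
    · rw [setNat_of_ne _ (by omega), h17]
    · rw [setNat_of_ne _ (by omega), h10]
    · convert hs using 1
      funext y
      by_cases hy : y = z
      · subst hy
        rw [if_neg fun e => hb (htest.2 e.2), if_neg fun e => hb (htest.2 e.2)]
      · simp only [hupd y hy]
  · rintro s ⟨h1, h2, -⟩
    simp only [Fin.is_lt, true_and] at h1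
    exact ⟨h1, h2⟩

theorem assignProgram_run (h : Stores v ω m rank order (fun _ => 0) B g s)
    (hG : GuaranteeState v (Set.range ω) n rank order B g) :
    Run assignProgram s (assignTime n) fun s =>
      ∃ label, Stores v ω m rank order label B g s ∧ LabelState n rank B label := by
  let Inv : ℕ → Memory → Prop := fun t s => ∃ label,
    Stores v ω m rank order label B g s ∧ LabelState t rank B label
  refine Run.forLoop (Inv := Inv) (N := playersE) (T := n * 4 + 5) ?_ ?_
    ⟨_, h, .start hG.rank_ne_zero⟩ ?_ (le_of_eq (by unfold assignTime; ring))
  · rintro x s ⟨_, hs, -⟩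
    exact hs.players
  · rintro x s y ⟨_, hs, hL⟩
    exact ⟨_, hs.setScalar (by omega) _ _ _, hL⟩
  · rintro t ht s ⟨label, hs, hL⟩ h18
    obtain ⟨i, hi, hr⟩ := hG.exists_order ⟨t, ht⟩
    refine Run.seq (Run.assign (Q := fun s => Stores v ω m rank order label B g s ∧
      s.nat 18 0 0 = t ∧ s.nat 17 0 0 = i) ⟨hs.setScalar (by omega) _ _ _, ?_, ?_⟩)
      (U := n * 4 + 3) ?_ (by omega)
    · rw [setNat_of_ne _ (by omega), h18]
    · have := hs.order ⟨t, ht⟩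
      simpa [setNat_self, Expr.eval, h18, hi] using this
    · rintro s₁ ⟨hs₁, h18₁, h17₁⟩
      have hli := hs₁.label i
      refine Run.ite (T := n * 4 + 2) (fun hb => ?_) (fun hb => ?_) le_rfl
      · simp only [holds_pos, eval_entry, eval_cell, h17₁, hli] at hb
        exact (Run.skip ⟨⟨label, hs₁, hL.step_assigned hG hr hb⟩, h18₁⟩).mono (fun _ h => h)
          (by omega)
      · simp only [holds_pos, eval_entry, eval_cell, h17₁, hli, ne_eq, not_not] at hb
        exact (labelProgram_run hs₁ h18₁ h17₁ (hG.mem i)).mono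
          (fun s' hs' => ⟨⟨_, hs'.1, hL.step_new hG hr hb⟩, hs'.2⟩) le_rfl

theorem time_le (n m : ℕ) :
    markTime n m + (eliminateTime n m + assignTime n) ≤ 100 * (n + m + 1) ^ 5 := by
  have hn : n ≤ n + m + 1 := by omega
  have hm : m ≤ n + m + 1 := by omega
  have h1 : 1 ≤ n + m + 1 := by omega
  generalize n + m + 1 = K at hn hm h1
  have hmono : markTime n m + (eliminateTime n m + assignTime n) ≤
      markTime K K + (eliminateTime K K + assignTime K) := by
    unfold markTime eliminateTime assignTime findTime bestTime leafTime scanTime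
    gcongr
  refine hmono.trans ?_
  have h0 : 1 ≤ K ^ 5 := Nat.one_le_pow _ _ h1
  have h2 : K ≤ K ^ 5 := Nat.le_self_pow (by norm_num) K
  have h3 : K ^ 2 ≤ K ^ 5 := Nat.pow_le_pow_right h1 (by norm_num)
  have h4 : K ^ 3 ≤ K ^ 5 := Nat.pow_le_pow_right h1 (by norm_num)
  have h5 : K ^ 4 ≤ K ^ 5 := Nat.pow_le_pow_right h1 (by norm_num)
  unfold markTime eliminateTime assignTime findTime bestTime leafTime scanTime
  ring_nf
  omega

open Classical in
/-- On all samples the program halts in time polynomial in `n` and `m`, with a feasible partition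
that no sample blocks. -/
theorem stabilizer_run {G : SimpleGraph (Fin n)} (hG : G.IsAcyclic) (hv : v ∈ gamesOn G)
    (ε δ : ℝ) (ω : Fin m → Finset (Fin n)) :
    Run stabilizer (inputMemory v ε δ ω) (100 * (n + m + 1) ^ 5) fun s =>
      (∀ j, ¬ StronglyBlocks v (outputPartition n s) (ω j)) ∧
        ∀ P ∈ (outputPartition n s).parts, Feasible G P := by
  have htime : markTime n m + (eliminateTime n m + assignTime n) ≤ 100 * (n + m + 1) ^ 5 :=
    time_le n m
  refine Run.seq (markProgram_run (Stores.start v ε δ ω)) (fun s hs =>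
    Run.seq (eliminateProgram_run hs (fun i => (hv i).1) (eliminable_nonnegative hG hv _))
      (fun s ⟨_, _, _, _, hs, hg⟩ => (assignProgram_run hs hg).mono ?_ le_rfl) le_rfl) htime
  · rintro s ⟨label, hs, hL⟩
    have hst := hL.stable hg hv (π := outputPartition n s) fun x y => by
      refine (Finpartition.mem_part_ofSetoid_iff_rel ..).trans ?_
      rw [Setoid.ker_def, hs.label, hs.label]
    exact ⟨fun j => hst.1 _ ⟨j, rfl⟩, hst.2⟩

end Correctness

/-! ### Efficient PAC stabilizability -/

/-- The sample size `m` and the number of steps are polynomial in `n`, `1 / ε` and `log (1 / δ)`,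
whose positive part is `L`. -/
theorem polynomial_bounds {n m : ℕ} {ε L X : ℝ} (hε : 0 < ε) (hL : 0 ≤ L)
    (hX : X = n + 1 / ε + L + 1) (hlt : (m : ℝ) < ((n : ℝ) ^ 2 + L) / ε + 1) :
    (m : ℝ) ≤ 24300 * X ^ 15 ∧ 100 * ((n : ℝ) + m + 1) ^ 5 ≤ 24300 * X ^ 15 := by
  have hn : (0 : ℝ) ≤ n := n.cast_nonneg
  have hε' : 0 < 1 / ε := by positivity
  have hX1 : 1 ≤ X := by linarith
  have hm : (m : ℝ) ≤ 2 * X ^ 3 := by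
    have h1 : (n : ℝ) ^ 2 + L ≤ X ^ 2 := calc
      (n : ℝ) ^ 2 + L ≤ (n + L + 1) ^ 2 := by nlinarith
      _ ≤ X ^ 2 := pow_le_pow_left₀ (by positivity) (by linarith) 2
    have h2 : ((n : ℝ) ^ 2 + L) / ε ≤ X ^ 2 * X := by
      rw [div_eq_mul_one_div]
      exact mul_le_mul h1 (by linarith) hε'.le (by positivity)
    have h3 : 1 ≤ X ^ 3 := one_le_pow₀ hX1
    linarith [pow_succ X 2]
  have hX3 : X ≤ X ^ 3 := le_self_pow₀ hX1 (by norm_num)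
  have hX15 : X ^ 3 ≤ X ^ 15 := pow_le_pow_right₀ hX1 (by norm_num)
  refine ⟨by linarith, ?_⟩
  calc (100 : ℝ) * (n + m + 1) ^ 5 ≤ 100 * (3 * X ^ 3) ^ 5 := by
        gcongr
        linarith
    _ = 24300 * X ^ 15 := by rw [mul_pow, ← pow_mul]; norm_num; ring

end HedonicPAC

theorem mainTheorem3 :
    HedonicPAC.EfficientlyPACStabilizable HedonicPAC.forestGames := by
  refine ⟨HedonicPAC.stabilizer,
    fun n ε δ => ⌈((n : ℝ) ^ 2 + max 0 (Real.log (1 / δ))) / ε⌉₊, 24300, 15, fun n ε δ hε hδ => ?_⟩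
  beta_reduce
  have hceil := Nat.le_ceil (((n : ℝ) ^ 2 + max 0 (Real.log (1 / δ))) / ε)
  have hlt := Nat.ceil_lt_add_one (a := ((n : ℝ) ^ 2 + max 0 (Real.log (1 / δ))) / ε)
    (by positivity)
  generalize ⌈((n : ℝ) ^ 2 + max 0 (Real.log (1 / δ))) / ε⌉₊ = m at hceil hlt ⊢
  obtain ⟨hm, htime⟩ := HedonicPAC.polynomial_bounds hε (le_max_left _ _) rfl hlt
  rw [Nat.cast_ofNat]
  refine ⟨hm, fun Γ hΓ => ⟨fun ω => ?_, fun D => ?_⟩⟩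
  · obtain ⟨s, t, he, ht, -⟩ := HedonicPAC.stabilizer_run hΓ.1 hΓ.2 ε δ ω
    refine ⟨s, t, he, le_trans ?_ htime⟩
    exact_mod_cast ht
  · refine HedonicPAC.le_sampleProb_of_consistent Γ.utility D hε hδ hceil _ fun ω => ?_
    obtain ⟨s, t, he, -, hblock, hfeas⟩ := HedonicPAC.stabilizer_run hΓ.1 hΓ.2 ε δ ω
    exact ⟨HedonicPAC.outputPartition n s, hblock, fun hst => ⟨s, t, he, hst, hfeas⟩⟩
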